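/- **Signatures, terms, flows.** A signature $\Sigma$ consists of constants and of function symbols of arity $\ge 1$; it is free if it has no constant. Terms are built from a countable set of variables. A flow $u\leftharpoonup t$ is an ordered pair of terms with the same variables, taken up to renaming of variables. If $u\leftharpoonup t$ and $u'\leftharpoonup t'$ have disjoint variables, their product is $u\theta\leftharpoonup t'\theta$ if $t,u'$ have a most general unifier $\theta$, and $0$ otherwise. A wiring is a finite sum of flows; wirings generate the algebra of formal integer combinations of flows, with unit $1=(x\leftharpoonup x)$ and involution $(u\leftharpoonup t)^*=t\leftharpoonup u$. If $\sigma,U$ are wirings such that $\sigma^*=\sigma$, $\sigma^2$ is a projection ($\sigma^4=\sigma^2$) and $U\sigma$ is nilpotent, put $$\mathrm{Ex}(U,\sigma)=(1-\sigma^2)\Big(\sum_{k\ge 0}U(\sigma U)^k\Big)(1-\sigma^2).$$ **The space $B(\Sigma)$.** If $\Sigma$ is not free, $B(\Sigma)$ is the discrete set of finite closed terms, with the counting measure $\lambda$. If $\Sigma$ is free and has at least two function symbols, $B(\Sigma)$ is the set of infinite trees coinductively generated by the function symbols; its topology is generated by the sets $\mathcal O(u)$ of all closed instances of a term $u$. It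 carries the Borel measure $\lambda=\sum_u w(u)\,\lambda_u$, where $u$ ranges over the terms, the $w(u)>0$ are summable weights, and $\lambda_u$ is the law of $u(T_0,T_1,\dots)$, the $T_n$ being independent random trees whose nodes are labelled independently according to a fixed probability law $p$ on the function symbols with $p(f)>0$ for all $f$. The choice of $w,p$ is arbitrary. **Graphings.** A transformation of $B(\Sigma)$ is non-singular measurable-preserving if it is measurable, maps measurable sets to measurable sets, and for measurable $A$ the image of $A$ is $\lambda$-null iff $A$ is. A graphing with measurable carrier $V$ and weights in a monoid $\Omega$ is a countable family of edges $e$, each with a weight in $\Omega$, a measurable source $S_e\subset V$, and a realiser $\phi_e$ that is the restriction to $S_e$ of a non-singular measurable-preserving transformation, with measurable target $T_e=\phi_e(S_e)\subset V$. An alternating path between graphings $F,G$ is a nonempty finite sequence of edges, alternately in $F$ and $G$ (starting in either), such that the target of each edge meets the source of the next in positive measure; its weight is the product of the weights and its partial map is the composite of the realisers. The execution $F \mathop{:\!m\!:} G$ has carrier $(V^F\cup V^G)\setminus C$, $C=V^F\cap V^G$; its edges are the alternating paths, with realiser restricted to the points outside $C$ whose image is outside $C$, whenever this restricted domain is not null.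 $P$ refines $F$ if there is a weight-preserving map $\theta$ from the edges of $P$ to those of $F$ such that, up to null sets, every source (target) of $F$ is the union of the sources (targets) of the edges above it, distinct edges with the same image have disjoint sources and targets, and the realisers agree on common sources. $F\sim G$ means that the graphings $F,G$ have a common refinement. For a wiring $W$, $[W]$ is the graphing with one edge of weight $1$, realised by $t(T_1,\dots,T_k)\mapsto u(T_1,\dots,T_k)$ from $\mathcal O(t)$ onto $\mathcal O(u)$, for each flow $u\leftharpoonup t$ of $W$, with any chosen measurable carrier that contains these sets. **Theorem.** Let $\Sigma$ be a signature which is either non-free, or free with at least two function symbols, $B(\Sigma)$ being equipped with $\lambda$ as above, and let $\Omega$ be any monoid. For each wiring $W$, $[W]$ is a graphing. The map $W\mapsto[W]$ commutes with execution: let $U,\sigma$ be wirings such that $\sigma^*=\sigma$, $\sigma^4=\sigma^2$ and $U\sigma$ is nilpotent; give $[\sigma]$ as carrier the union of the sources and targets of its edges, and $[U]$ any measurable carrier containing both the sources and targets of the edges of $[U]$ and the carrier of $[\sigma]$. Then: 1. if $\mathrm{Ex}(U,\sigma)$ is a wiring $W$, then $[W]\sim[U]\mathop{:\!m\!:}[\sigma]$;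 2. in general, if $\mathrm{Ex}(U,\sigma)=W-W'$ with $W,W'$ wirings, then $[W]\sim([U]\mathop{:\!m\!:}[\sigma])\uplus[W']$ (disjoint union of families of edges). -/

import Mathlib

open MeasureTheory

universe u v w

noncomputable section

namespace Unification

/-! ### Graphings on a measure space

A graphing is given by its raw data; `Graphing.IsGraphing` says that these data form an actual
graphing (measurability, countability, realisers in the macrocosm). The realiser of the edge `e`
is the restriction of the total map `real e` to the source `src e`. -/

/-- Non-singular measurable-preserving transformations of a measure space. -/
structure InMacrocosm {X : Type u} [MeasurableSpace X] (μ : Measure X) (f : X → X) : Prop where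
  measurable : Measurable f
  image_measurable : ∀ A, MeasurableSet A → MeasurableSet (f '' A)
  nonsingular : ∀ A, MeasurableSet A → (μ (f '' A) = 0 ↔ μ A = 0)

/-- Data of an `Ω`-weighted family of partial maps with a carrier. -/
structure Graphing (Ω : Type w) (X : Type u) where
  carrier : Set X
  E : Type
  weight : E → Ω
  src : E → Set X
  real : E → X → X

namespace Graphing

variable {Ω : Type w} {X : Type u}

/-- The target of an edge is the image of its source by its realiser. -/
def tgt (F : Graphing Ω X) (e : F.E) : Set X := F.real e '' F.src e

/-- The conditions for the data to be a graphing (in the macrocosm of `μ`). -/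
structure IsGraphing [MeasurableSpace X] (μ : Measure X) (F : Graphing Ω X) : Prop where
  carrier_measurable : MeasurableSet F.carrier
  countable : Countable F.E
  src_measurable : ∀ e, MeasurableSet (F.src e)
  src_subset : ∀ e, F.src e ⊆ F.carrier
  real_mem : ∀ e, InMacrocosm μ (F.real e)
  tgt_measurable : ∀ e, MeasurableSet (F.tgt e)
  tgt_subset : ∀ e, F.tgt e ⊆ F.carrier

/-- Disjoint union of the families of edges. -/
def disjUnion (F G : Graphing Ω X) : Graphing Ω X where
  carrier := F.carrier ∪ G.carrier
  E := F.E ⊕ G.E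
  weight := Sum.elim F.weight G.weight
  src := Sum.elim F.src G.src
  real := Sum.elim F.real G.real

/-- The partial map of a sequence of edges `e₀, …, eₙ` is `φ_{eₙ} ∘ ⋯ ∘ φ_{e₀}`, defined on
`pathSrc`. -/
def pathReal (F : Graphing Ω X) : List F.E → X → X
  | [] => id
  | e :: π => pathReal F π ∘ F.real e

/-- The domain of the partial map of a sequence of edges. -/
def pathSrc (F : Graphing Ω X) : List F.E → Set X
  | [] => Set.univ
  | e :: π => F.src e ∩ F.real e ⁻¹' pathSrc F π

def pathWeight [Monoid Ω] (F : Graphing Ω X) (π : List F.E) : Ω := (π.map F.weight).prod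

/-- Paths are nonempty sequences of edges such that consecutive edges satisfy that the target of
the first meets the source of the second in positive measure. -/
def IsPath [MeasurableSpace X] (μ : Measure X) (F : Graphing Ω X) (π : List F.E) : Prop :=
  π ≠ [] ∧ π.IsChain (fun e e' => μ (F.tgt e ∩ F.src e') ≠ 0)

/-- Alternating paths between `F` and `G`. -/
def IsAltPath [MeasurableSpace X] (μ : Measure X) (F G : Graphing Ω X)
    (π : List (F.E ⊕ G.E)) : Prop :=
  IsPath μ (F.disjUnion G) π ∧ π.IsChain (fun e e' => e.isLeft ≠ e'.isLeft)

/-- The location of the cut. -/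
def cut (F G : Graphing Ω X) : Set X := F.carrier ∩ G.carrier

/-- The domain of the part of the path `π` whose source and target lie outside of the cut. -/
def outerSrc (F G : Graphing Ω X) (π : List (F.E ⊕ G.E)) : Set X :=
  (F.disjUnion G).pathSrc π ∩ (cut F G)ᶜ ∩ (F.disjUnion G).pathReal π ⁻¹' (cut F G)ᶜ

/-- Execution of two graphings: the outer parts of alternating paths. -/
def execution [Monoid Ω] [MeasurableSpace X] (μ : Measure X) (F G : Graphing Ω X) :
    Graphing Ω X where
  carrier := (F.carrier ∪ G.carrier) \ cut F G
  E := {π : List (F.E ⊕ G.E) // IsAltPath μ F G π ∧ μ (outerSrc F G π) ≠ 0}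
  weight := fun π => (F.disjUnion G).pathWeight π.1
  src := fun π => outerSrc F G π.1
  real := fun π => (F.disjUnion G).pathReal π.1

/-- `F` is a refinement of `G`. -/
def IsRefinement [MeasurableSpace X] (μ : Measure X) (F G : Graphing Ω X) : Prop :=
  ∃ θ : F.E → G.E,
    (∀ e e', θ e = θ e' → e ≠ e' →
      μ (F.src e ∩ F.src e') = 0 ∧ μ (F.tgt e ∩ F.tgt e') = 0) ∧
    (∀ e, G.weight (θ e) = F.weight e) ∧
    (∀ f, μ (symmDiff (G.src f) (⋃ e ∈ θ ⁻¹' {f}, F.src e)) = 0) ∧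
    (∀ f, μ (symmDiff (G.tgt f) (⋃ e ∈ θ ⁻¹' {f}, F.tgt e)) = 0) ∧
    (∀ e, ∀ᵐ x ∂μ, x ∈ G.src (θ e) ∩ F.src e → G.real (θ e) x = F.real e x)

/-- `F` and `G` are graphings that have a common refinement. -/
def RefEquiv [MeasurableSpace X] (μ : Measure X) (F G : Graphing Ω X) : Prop :=
  F.IsGraphing μ ∧ G.IsGraphing μ ∧
    ∃ P : Graphing Ω X, P.IsGraphing μ ∧ P.IsRefinement μ F ∧ P.IsRefinement μ G

end Graphing

/-! ### Flows, wirings and the unification algebra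

A signature is a first-order language `L` without relation symbols: the constants are
`L.Functions 0`, and `L.Functions (n + 1)` are the function symbols of arity `n + 1`. Terms use
the variables `ℕ`. -/

variable {L : FirstOrder.Language.{u, v}}

/-- A flow `u ↼ t`: an ordered pair of terms with the same variables. -/
structure Flow (L : FirstOrder.Language.{u, v}) where
  u : L.Term ℕ
  t : L.Term ℕ
  vars_eq : u.varFinset = t.varFinset

/-- Flows are considered up to renaming of their variables. -/
instance Flow.setoid (L : FirstOrder.Language.{u, v}) : Setoid (Flow L) where
  r F G := ∃ π : Equiv.Perm ℕ, F.u.relabel π = G.u ∧ F.t.relabel π = G.t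
  iseqv :=
    { refl := fun F => ⟨1, by
        simp only [Equiv.Perm.coe_one, FirstOrder.Language.Term.relabel_id, and_self]⟩
      symm := by
        rintro F G ⟨π, h1, h2⟩
        refine ⟨π.symm, ?_, ?_⟩
        · rw [← h1, FirstOrder.Language.Term.relabel_relabel, Equiv.symm_comp_self,
            FirstOrder.Language.Term.relabel_id]
        · rw [← h2, FirstOrder.Language.Term.relabel_relabel, Equiv.symm_comp_self,
            FirstOrder.Language.Term.relabel_id]
      trans := by
        rintro F G H ⟨π, h1, h2⟩ ⟨ρ, h3, h4⟩
        refine ⟨π.trans ρ, ?_, ?_⟩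
        · rw [← h3, ← h1, FirstOrder.Language.Term.relabel_relabel, Equiv.coe_trans]
        · rw [← h4, ← h2, FirstOrder.Language.Term.relabel_relabel, Equiv.coe_trans] }

/-- Flows up to renaming. -/
abbrev FlowClass (L : FirstOrder.Language.{u, v}) := Quotient (Flow.setoid L)

/-- The adjoint `t ↼ u` of the flow `u ↼ t`. -/
def Flow.adj (F : Flow L) : Flow L := ⟨F.t, F.u, F.vars_eq.symm⟩

def FlowClass.adj : FlowClass L → FlowClass L :=
  Quotient.map Flow.adj (by rintro F G ⟨π, h1, h2⟩; exact ⟨π, h2, h1⟩)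

/-- `θ` is a principal (most general) unifier of `a` and `b`. -/
def IsMGU (θ : ℕ → L.Term ℕ) (a b : L.Term ℕ) : Prop :=
  a.subst θ = b.subst θ ∧
    ∀ η : ℕ → L.Term ℕ, a.subst η = b.subst η → ∃ ρ : ℕ → L.Term ℕ, ∀ n, η n = (θ n).subst ρ

/-- `H` is the composition `F · G`: for representatives `u ↼ t` of `F` and `u' ↼ t'` of `G` with
disjoint sets of variables, and `θ` a principal unifier of `t` and `u'`, `H` is `uθ ↼ t'θ`. -/
def FlowClass.IsComp (F G H : FlowClass L) : Prop :=
  ∃ f g h : Flow L, Quotient.mk _ f = F ∧ Quotient.mk _ g = G ∧ Quotient.mk _ h = H ∧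
    Disjoint f.t.varFinset g.u.varFinset ∧
    ∃ θ, IsMGU θ f.t g.u ∧ h.u = f.u.subst θ ∧ h.t = g.t.subst θ

/-- The unification algebra: formal sums of flows with integer coefficients (negative
coefficients are there because of the expression `1 - σ²`). -/
def UAlg (L : FirstOrder.Language.{u, v}) : Type u := FlowClass L →₀ ℤ

instance : AddCommGroup (UAlg L) := inferInstanceAs (AddCommGroup (FlowClass L →₀ ℤ))

/-- The flow class `F` as an element of the algebra. -/
def UAlg.of (F : FlowClass L) : UAlg L := Finsupp.single F (1 : ℤ)

open Classical in
/-- Composition of flows, equal to `0` when there is no principal unifier. -/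
def FlowClass.comp (F G : FlowClass L) : UAlg L :=
  if h : ∃ H, FlowClass.IsComp F G H then UAlg.of h.choose else 0

/-- Bilinear extension of the composition of flows. -/
instance : Mul (UAlg L) where
  mul a b := Finsupp.sum (M := ℤ) a fun F m =>
    Finsupp.sum (M := ℤ) b fun G n => (m * n) • FlowClass.comp F G

/-- The identity is the flow `x ↼ x`. -/
instance : One (UAlg L) where
  one := UAlg.of (Quotient.mk _ ⟨FirstOrder.Language.Term.var 0, FirstOrder.Language.Term.var 0, rfl⟩)

instance : Pow (UAlg L) ℕ := ⟨fun a n => npowRec n a⟩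

/-- The involution induced by `u ↼ t ↦ t ↼ u`. -/
def UAlg.adj (a : UAlg L) : UAlg L := Finsupp.mapDomain (M := ℤ) FlowClass.adj a

/-- A wiring is a (finite) sum of flows. -/
abbrev Wiring (L : FirstOrder.Language.{u, v}) := List (Flow L)

/-- The element of the unification algebra that the wiring represents. -/
def Wiring.toAlg (W : Wiring L) : UAlg L := (W.map fun F => UAlg.of (Quotient.mk _ F)).sum

/-- The execution formula `(1 - σ²) (∑ₖ U (σ U)ᵏ) (1 - σ²)`. -/
def UAlg.ex (U σ : UAlg L) : UAlg L :=
  (1 - σ ^ 2) * (∑ᶠ k : ℕ, U * (σ * U) ^ k) * (1 - σ ^ 2)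

/-! ### The graphing of a wiring

Here `X` is a set of closed terms on which the function symbols act. -/

section Realisation

variable {X : Type u} [L.Structure X]

variable (X) in
/-- `𝒪(t)`: the set of the closed terms that are instances of `t`. -/
def openTerm (t : L.Term ℕ) : Set X := Set.range fun T : ℕ → X => t.realize T

open Classical in
/-- The map `t(T₁, …, Tₖ) ↦ u(T₁, …, Tₖ)` on `𝒪(t)`, extended by the identity. -/
def Flow.map (F : Flow L) (x : X) : X :=
  if h : ∃ T : ℕ → X, F.t.realize T = x then F.u.realize h.choose else x

variable (X) in
/-- The support of a wiring: union of the sources and targets of its flows. -/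
def Wiring.supp (W : Wiring L) : Set X := ⋃ F ∈ W, (openTerm X F.t ∪ openTerm X F.u)

/-- The graphing `[W]`, with carrier `V`: one edge of weight `1` for each flow of `W`. -/
def Wiring.graphing (Ω : Type w) [Monoid Ω] (W : Wiring L) (V : Set X) : Graphing Ω X where
  carrier := V
  E := Fin W.length
  weight := fun _ => 1
  src := fun i => openTerm X (W.get i).t
  real := fun i => (W.get i).map

end Realisation

/-! ### The spaces `B(Σ)` -/

/-- Non-free case: (finite) closed terms. -/
def ClosedTerm (L : FirstOrder.Language.{u, v}) : Type u := L.Term Empty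

instance [L.IsAlgebraic] : L.Structure (ClosedTerm L) where
  funMap := fun f ts => FirstOrder.Language.Term.func f ts

/-- The Borel sets of the discrete topology. -/
instance : MeasurableSpace (ClosedTerm L) := ⊤

/-- All the symbols of a signature (the function symbols, if the signature is free). -/
def Sym (L : FirstOrder.Language.{u, v}) : Type u := Σ n, L.Functions n

instance : MeasurableSpace (Sym L) := ⊤

/-- Free case: the closed terms are the (infinite) trees coinductively generated by the function
symbols. -/
def Tree (L : FirstOrder.Language.{u, v}) : Type u :=
  PFunctor.M (⟨Sym L, fun f => Fin f.1⟩ : PFunctor.{u, 0})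

instance [L.IsAlgebraic] : L.Structure (Tree L) where
  funMap := fun {n} f ts => PFunctor.M.mk ⟨⟨n, f⟩, ts⟩

/-- The topology of `B(Σ)` is generated by the sets `𝒪(u)`. -/
instance [L.IsAlgebraic] : TopologicalSpace (Tree L) :=
  TopologicalSpace.generateFrom (Set.range (openTerm (L := L) (Tree L)))

instance [L.IsAlgebraic] : MeasurableSpace (Tree L) := borel (Tree L)

/-- The tree whose node at the position `p` is labelled by `ω p`. A position is the list of the
directions from the root, the last one first. -/
def growTree (ω : List ℕ → Sym L) : Tree L :=
  PFunctor.M.corec (F := (⟨Sym L, fun f => Fin f.1⟩ : PFunctor.{u, 0}))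
    (fun p : List ℕ => ⟨ω p, fun i => (i : ℕ) :: p⟩) []

/-- The law of the random closed term `u(T₀, T₁, …)`, where the `Tₙ` are independent random trees
whose nodes are labelled independently with law `p`. -/
def instanceLaw [L.IsAlgebraic] (p : PMF (Sym L)) (u : L.Term ℕ) : Measure (Tree L) :=
  (Measure.infinitePi fun _ : ℕ × List ℕ => p.toMeasure).map
    fun ω => u.realize fun n => growTree fun q => ω (n, q)

/-- The measure `∑ᵤ w(u) · law of u(T₀, T₁, …)` on `B(Σ)`, for `Σ` free. -/
def treeMeasure [L.IsAlgebraic] (p : PMF (Sym L)) (w : L.Term ℕ → ENNReal) :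
    Measure (Tree L) :=
  Measure.sum fun u => w u • instanceLaw p u

/-! ### Commutation with execution -/

/-- The map `W ↦ [W]` sends wirings to graphings and commutes with execution. The pair `(U, σ)`
satisfies: `σ` is hermitian, `σ²` is a projection, `Uσ` is nilpotent; the carrier `V` of `[U]`
contains the location of the cut, which is the carrier of `[σ]`. -/
def CommutesWithExecution (L : FirstOrder.Language.{u, v}) (Ω : Type w) [Monoid Ω] {X : Type u}
    [L.Structure X] [MeasurableSpace X] (μ : Measure X) : Prop :=
  (∀ W : Wiring L, ∀ V : Set X, MeasurableSet V → W.supp X ⊆ V →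
    (W.graphing Ω V).IsGraphing μ) ∧
  ∀ U σ : Wiring L,
    UAlg.adj σ.toAlg = σ.toAlg →
    σ.toAlg ^ 2 * σ.toAlg ^ 2 = σ.toAlg ^ 2 →
    (∃ n : ℕ, (U.toAlg * σ.toAlg) ^ n = 0) →
    ∀ V : Set X, MeasurableSet V → U.supp X ⊆ V → σ.supp X ⊆ V →
      -- if the execution formula yields the wiring `W`
      (∀ W : Wiring L, W.toAlg = UAlg.ex U.toAlg σ.toAlg →
        Graphing.RefEquiv μ (W.graphing Ω Set.univ)
          (Graphing.execution μ (U.graphing Ω V) (σ.graphing Ω (σ.supp X)))) ∧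
      -- in general it yields a difference `W - W'` of wirings
      (∀ W W' : Wiring L, W.toAlg - W'.toAlg = UAlg.ex U.toAlg σ.toAlg →
        Graphing.RefEquiv μ (W.graphing Ω Set.univ)
          (Graphing.disjUnion
            (Graphing.execution μ (U.graphing Ω V) (σ.graphing Ω (σ.supp X)))
            (W'.graphing Ω Set.univ)))

end Unification

end

/-! Each flow u ↼ t acts on points as the partial injection t(T) ↦ u(T), so an element of the
unification algebra acts on formal integer combinations of points. `UAlg.ket x a` is the column at x
of the matrix of a. The theorem follows by reading the entries of the matrix of Ex(U,σ) as numbers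
of edges.

The action is multiplicative at x if two terms having x as a common instance have a syntactic common
instance through x. This holds for all finite closed terms, but fails for some infinite trees:
f(x,x) and f(y,g(y)) are not unifiable, yet both have an instance at y = g(g(…)). Hence a set of
good points is isolated (`IsUnifying`), stable under flows and of full measure, on which composition
of flows is composition of maps (`UAlg.ket_comp`, `UAlg.ket_mul`).

On good points, σ² is a symmetric idempotent integer matrix, hence diagonal with entries 0 and 1
(`UAlg.ket_sq_of_isPartialSymmetry`), and 1 - σ² is the restriction to the complement of the cut.
Sums of flows have nonnegative entries and act faithfully, so nilpotency makes the execution formula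
a finite sum. Its entry at (x, y) is the number of alternating paths from x to y with both ends
outside the cut (`ae_encard_execution`). The entries of a wiring W count the edges of [W] in the
same way. Two graphings with injective edges of one common weight and the same numbers of edges from
x to y, for almost every x, have a common refinement: match edges of equal rank among those from x
to y (`Graphing.refEquiv_of_encard`).

For trees, good points are the values of finite terms at generic trees, that is, trees all of whose
subtrees are distinct. Such trees behave as free variables. With two symbols of positive
probability, independent random trees are almost surely generic (`Tree.ae_injectiveGrowth`). Flows
are non-singular because λ charges the random instances of every term: if a set of instances of u
has positive measure, truncating random trees deeply enough shows that it is charged by the law of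
some uθ, and the flow carries the law of tθ to that of uθ (`Tree.treeMeasure_image_eq_zero`). -/

noncomputable section

namespace Unification

open FirstOrder FirstOrder.Language

variable {L : FirstOrder.Language.{u, v}}

/-! ### Terms and substitutions -/

section Terms

variable {α β γ : Type*}

/-- The set of the variables of a term. -/
def termVars : L.Term α → Set α
  | .var a => {a}
  | .func _ ts => ⋃ i, termVars (ts i)

@[simp] theorem mem_termVars_var {a b : α} : a ∈ termVars (Term.var b : L.Term α) ↔ a = b :=
  Iff.rfl

@[simp] theorem mem_termVars_func {a : α} {n : ℕ} {f : L.Functions n} {ts : Fin n → L.Term α} :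
    a ∈ termVars (Term.func f ts) ↔ ∃ i, a ∈ termVars (ts i) := by
  simp [termVars]

theorem mem_varFinset_iff [DecidableEq α] (t : L.Term α) (a : α) :
    a ∈ t.varFinset ↔ a ∈ termVars t := by
  induction t with
  | var b => simp
  | func f ts ih => simp [ih]

theorem finite_termVars (t : L.Term α) : (termVars t).Finite := by
  classical
  refine t.varFinset.finite_toSet.subset fun a ha => ?_
  exact (mem_varFinset_iff t a).2 ha

theorem subst_congr (t : L.Term α) {s s' : α → L.Term β} (h : ∀ a ∈ termVars t, s a = s' a) :
    t.subst s = t.subst s' := by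
  induction t with
  | var b => exact h b rfl
  | func f ts ih =>
    simp only [Term.subst]
    congr 1
    funext i
    exact ih i fun a ha => h a (mem_termVars_func.2 ⟨i, ha⟩)

theorem realize_congr {X : Type*} [L.Structure X] (t : L.Term α) {s s' : α → X}
    (h : ∀ a ∈ termVars t, s a = s' a) : t.realize s = t.realize s' := by
  induction t with
  | var b => exact h b rfl
  | func f ts ih =>
    simp only [Term.realize_func]
    congr 1
    funext i
    exact ih i fun a ha => h a (mem_termVars_func.2 ⟨i, ha⟩)

theorem subst_subst (t : L.Term α) (s : α → L.Term β) (s' : β → L.Term γ) :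
    (t.subst s).subst s' = t.subst fun a => (s a).subst s' := by
  induction t with
  | var b => rfl
  | func f ts ih => simp [ih]

theorem subst_var (t : L.Term α) : t.subst Term.var = t := by
  induction t with
  | var b => rfl
  | func f ts ih => simp [ih]

theorem relabel_subst (t : L.Term α) (g : α → β) (s : β → L.Term γ) :
    (t.relabel g).subst s = t.subst fun a => s (g a) := by
  induction t with
  | var b => rfl
  | func f ts ih => simp [ih]

theorem subst_relabel (t : L.Term α) (s : α → L.Term β) (g : β → γ) :
    (t.subst s).relabel g = t.subst fun a => (s a).relabel g := by
  induction t with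
  | var b => rfl
  | func f ts ih => simp [ih]

theorem mem_termVars_subst {t : L.Term α} {s : α → L.Term β} {b : β} :
    b ∈ termVars (t.subst s) ↔ ∃ a ∈ termVars t, b ∈ termVars (s a) := by
  induction t with
  | var a => simp
  | func f ts ih =>
    simp only [Term.subst, mem_termVars_func, ih]
    aesop

theorem mem_termVars_relabel {t : L.Term α} {g : α → β} {b : β} :
    b ∈ termVars (t.relabel g) ↔ ∃ a ∈ termVars t, g a = b := by
  induction t with
  | var a => simp [eq_comm]
  | func f ts ih =>
    simp only [Term.relabel, mem_termVars_func, ih]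
    aesop

theorem relabel_congr (t : L.Term α) {g g' : α → β} (h : ∀ a ∈ termVars t, g a = g' a) :
    t.relabel g = t.relabel g' := by
  induction t with
  | var b => simp [h b rfl]
  | func f ts ih =>
    simp only [Term.relabel]
    congr 1
    funext i
    exact ih i fun a ha => h a (mem_termVars_func.2 ⟨i, ha⟩)

/-- The number of symbols and variable occurrences of a term. -/
def termSize : L.Term α → ℕ
  | .var _ => 1
  | .func _ ts => 1 + ∑ i, termSize (ts i)

theorem termSize_le_of_mem {t : L.Term α} {a : α} (h : a ∈ termVars t) (s : α → L.Term β) :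
    termSize (s a) ≤ termSize (t.subst s) := by
  induction t with
  | var b => rw [mem_termVars_var.1 h]; rfl
  | func f ts ih =>
    obtain ⟨i, hi⟩ := mem_termVars_func.1 h
    simp only [Term.subst, termSize]
    have := Finset.single_le_sum (f := fun i => termSize ((ts i).subst s))
      (fun _ _ => Nat.zero_le _) (Finset.mem_univ i)
    have := ih i hi
    omega

/-- Occurs check: the instance of a variable strictly inside a term is strictly smaller than the
instance of the term. -/
theorem subst_func_ne_of_mem {a : α} {n : ℕ} {f : L.Functions n} {ts : Fin n → L.Term α}
    (h : a ∈ termVars (Term.func f ts)) (s : α → L.Term β) : s a ≠ (Term.func f ts).subst s := by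
  intro he
  obtain ⟨i, hi⟩ := mem_termVars_func.1 h
  have h1 := termSize_le_of_mem hi s
  have h2 := congrArg termSize he
  have := Finset.single_le_sum (f := fun i => termSize ((ts i).subst s))
    (fun _ _ => Nat.zero_le _) (Finset.mem_univ i)
  simp only [Term.subst, termSize] at *
  omega

end Terms

/-! ### Principal unifiers -/

/-- `η` unifies all the equations of a list. -/
def Unifies (η : ℕ → L.Term ℕ) (E : List (L.Term ℕ × L.Term ℕ)) : Prop :=
  ∀ e ∈ E, e.1.subst η = e.2.subst η

/-- `θ` is a principal unifier of a list of equations. -/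
def IsListMGU (θ : ℕ → L.Term ℕ) (E : List (L.Term ℕ × L.Term ℕ)) : Prop :=
  Unifies θ E ∧ ∀ η, Unifies η E → ∃ ρ : ℕ → L.Term ℕ, ∀ n, η n = (θ n).subst ρ

theorem unifies_cons {η : ℕ → L.Term ℕ} {e : L.Term ℕ × L.Term ℕ}
    {E : List (L.Term ℕ × L.Term ℕ)} :
    Unifies η (e :: E) ↔ e.1.subst η = e.2.subst η ∧ Unifies η E := by
  simp [Unifies]

theorem IsListMGU.congr {θ : ℕ → L.Term ℕ} {E E' : List (L.Term ℕ × L.Term ℕ)}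
    (h : ∀ η, Unifies η E ↔ Unifies η E') (hθ : IsListMGU θ E) : IsListMGU θ E' :=
  ⟨(h θ).1 hθ.1, fun η hη => hθ.2 η ((h η).2 hη)⟩

/-- The variables of a list of equations. -/
def listVars (E : List (L.Term ℕ × L.Term ℕ)) : Finset ℕ :=
  E.foldr (fun e s => e.1.varFinset ∪ e.2.varFinset ∪ s) ∅


theorem mem_listVars {E : List (L.Term ℕ × L.Term ℕ)} {n : ℕ} :
    n ∈ listVars E ↔ ∃ e ∈ E, n ∈ termVars e.1 ∨ n ∈ termVars e.2 := by
  induction E with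
  | nil => simp [listVars]
  | cons e E ih =>
    have : listVars (e :: E) = e.1.varFinset ∪ e.2.varFinset ∪ listVars E := rfl
    simp [this, ih, mem_varFinset_iff, or_assoc]

/-- The size of a list of equations. -/
def listSize (E : List (L.Term ℕ × L.Term ℕ)) : ℕ :=
  (E.map fun e => termSize e.1 + termSize e.2).sum

/-- The substitution of `t` for the variable `x`. -/
def elimSubst (x : ℕ) (t : L.Term ℕ) : ℕ → L.Term ℕ := fun k => if k = x then t else .var k

theorem subst_elimSubst_of_notMem {x : ℕ} {t s : L.Term ℕ} (h : x ∉ termVars s) :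
    s.subst (elimSubst x t) = s := by
  conv_rhs => rw [← subst_var s]
  refine subst_congr _ fun a ha => ?_
  have : a ≠ x := fun h' => h (h' ▸ ha)
  simp [elimSubst, this]

/-- Every unifier η of x = t factors as η after the substitution τ of t for x. It therefore unifies
the remaining equations after substitution, which no longer contain x; τ followed by a principal
unifier of these is principal. -/
theorem exists_listMGU_elim {x : ℕ} {t : L.Term ℕ} (hx : x ∉ termVars t)
    {E : List (L.Term ℕ × L.Term ℕ)}
    (ih : ∀ E' : List (L.Term ℕ × L.Term ℕ),
      (listVars E').card < (listVars ((.var x, t) :: E)).card → (∃ η, Unifies η E') →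
        ∃ θ, IsListMGU θ E')
    (hη : ∃ η, Unifies η ((.var x, t) :: E)) : ∃ θ, IsListMGU θ ((.var x, t) :: E) := by
  set τ := elimSubst x t with hτ
  set E' := E.map fun e => (e.1.subst τ, e.2.subst τ) with hE'
  have key : ∀ η, Unifies η ((.var x, t) :: E) → (∀ k, η k = (τ k).subst η) ∧ Unifies η E' := by
    intro η h
    rw [unifies_cons] at h
    have h1 : ∀ k, η k = (τ k).subst η := by
      intro k
      by_cases hk : k = x
      · simpa [hτ, elimSubst, hk] using h.1
      · simp [hτ, elimSubst, hk]
    refine ⟨h1, fun e he => ?_⟩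
    obtain ⟨e', he', rfl⟩ := List.mem_map.1 he
    simp only [subst_subst, ← h1]
    exact h.2 e' he'
  have hsub : listVars E' ⊆ (listVars ((.var x, t) :: E)).erase x := by
    have hv : ∀ (s : L.Term ℕ) n, n ∈ termVars (s.subst τ) →
        n ≠ x ∧ (n ∈ termVars s ∨ n ∈ termVars t) := by
      intro s n hn
      obtain ⟨a, ha, hn⟩ := mem_termVars_subst.1 hn
      by_cases hk : a = x
      · simp only [hτ, elimSubst, hk, if_true] at hn
        exact ⟨fun h => hx (h ▸ hn), Or.inr hn⟩
      · simp only [hτ, elimSubst, hk, if_false, mem_termVars_var] at hn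
        exact ⟨hn ▸ hk, Or.inl (hn ▸ ha)⟩
    intro n hn
    obtain ⟨e, he, h⟩ := mem_listVars.1 hn
    obtain ⟨e', he', rfl⟩ := List.mem_map.1 he
    rw [Finset.mem_erase, mem_listVars]
    rcases h with h | h
    · obtain ⟨h1, h2 | h2⟩ := hv _ _ h
      · exact ⟨h1, e', List.mem_cons_of_mem _ he', Or.inl h2⟩
      · exact ⟨h1, _, List.mem_cons_self, Or.inr h2⟩
    · obtain ⟨h1, h2 | h2⟩ := hv _ _ h
      · exact ⟨h1, e', List.mem_cons_of_mem _ he', Or.inr h2⟩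
      · exact ⟨h1, _, List.mem_cons_self, Or.inr h2⟩
  have hxmem : x ∈ listVars ((.var x, t) :: E) :=
    mem_listVars.2 ⟨_, List.mem_cons_self, Or.inl rfl⟩
  obtain ⟨η, hη⟩ := hη
  obtain ⟨θ', hθ', hmg⟩ := ih E' ((Finset.card_le_card hsub).trans_lt
    (Finset.card_erase_lt_of_mem hxmem)) ⟨η, (key η hη).2⟩
  refine ⟨fun k => (τ k).subst θ', unifies_cons.2 ⟨?_, fun e he => ?_⟩, fun η hη => ?_⟩
  · simp only [Term.subst, ← subst_subst]
    rw [subst_elimSubst_of_notMem hx]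
    simp [hτ, elimSubst]
  · simp only [← subst_subst]
    exact hθ' _ (List.mem_map.2 ⟨e, he, rfl⟩)
  · obtain ⟨h1, h2⟩ := key η hη
    obtain ⟨ρ, hρ⟩ := hmg η h2
    refine ⟨ρ, fun n => ?_⟩
    rw [h1 n, subst_subst]
    exact subst_congr _ fun a _ => hρ a

/-- Unification algorithm, by lexicographic induction on the number of variables and the total size.
Eliminating a variable lowers the first measure; dropping x = x or decomposing two applications
lowers the second without adding variables. Clashes and failed occurs checks are excluded by the
given unifier. -/
theorem exists_listMGU_aux (n : ℕ) : ∀ (m : ℕ) (E : List (L.Term ℕ × L.Term ℕ)),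
    (listVars E).card ≤ n → listSize E ≤ m → (∃ η, Unifies η E) → ∃ θ, IsListMGU θ E := by
  induction n using Nat.strong_induction_on with
  | _ n ihn =>
  intro m
  induction m using Nat.strong_induction_on with
  | _ m ihm =>
  intro E hn hm hη
  have ihE : ∀ x t E₀, (listVars ((.var x, t) :: E₀)).card ≤ n → x ∉ termVars t →
      (∃ η, Unifies η ((.var x, t) :: E₀)) → ∃ θ, IsListMGU θ ((.var x, t) :: E₀) :=
    fun x t E₀ hc hx h => exists_listMGU_elim hx
      (fun E' hE' h' => ihn _ (hE'.trans_le hc) _ E' le_rfl le_rfl h') h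
  have swap : ∀ (a b : L.Term ℕ) E₀ η, Unifies η ((a, b) :: E₀) ↔ Unifies η ((b, a) :: E₀) := by
    intro a b E₀ η
    rw [unifies_cons, unifies_cons]
    exact and_congr_left fun _ => eq_comm
  match E, hn, hm, hη with
  | [], _, _, _ => exact ⟨.var, by simp [Unifies], fun η _ => ⟨η, fun n => rfl⟩⟩
  | (.var x, .var y) :: E, hn, hm, hη =>
    by_cases hxy : x = y
    · subst hxy
      have hsub : listVars E ⊆ listVars ((.var x, .var x) :: E) := fun k hk => by
        obtain ⟨e, he, h⟩ := mem_listVars.1 hk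
        exact mem_listVars.2 ⟨e, List.mem_cons_of_mem _ he, h⟩
      have hs : listSize ((.var x, .var x) :: E) = 2 + listSize E := by simp [listSize, termSize]
      obtain ⟨η, hη⟩ := hη
      obtain ⟨θ, hθ⟩ := ihm (listSize E) (by omega) E ((Finset.card_le_card hsub).trans hn) le_rfl
        ⟨η, (unifies_cons.1 hη).2⟩
      exact ⟨θ, hθ.congr fun η => by rw [unifies_cons]; simp⟩
    · exact ihE x (.var y) E hn (by simpa using hxy) hη
  | (.var x, .func f ts) :: E, hn, hm, hη =>
    refine ihE x _ E hn (fun hx => ?_) hη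
    obtain ⟨η, hη⟩ := hη
    exact subst_func_ne_of_mem hx η (unifies_cons.1 hη).1
  | (.func f ts, .var x) :: E, hn, hm, hη =>
    obtain ⟨η, hη⟩ := hη
    have hv : listVars ((.var x, .func f ts) :: E) = listVars ((.func f ts, .var x) :: E) := by
      ext k
      simp only [mem_listVars, List.mem_cons, exists_eq_or_imp]
      exact or_congr_left or_comm
    obtain ⟨θ, hθ⟩ := ihE x (.func f ts) E (hv ▸ hn) (fun hx =>
      subst_func_ne_of_mem hx η (unifies_cons.1 hη).1.symm) ⟨η, (swap _ _ _ _).1 hη⟩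
    exact ⟨θ, hθ.congr fun η => swap _ _ _ _⟩
  | (.func (l := l) f ts, .func (l := l') g us) :: E, hn, hm, hη =>
    obtain ⟨η, hη⟩ := hη
    have h0 := (unifies_cons.1 hη).1
    simp only [Term.subst] at h0
    obtain ⟨hl, hfg, -⟩ := Term.func.inj h0
    subst hl
    obtain rfl := eq_of_heq hfg
    -- Decomposition: the two head symbols disappear, so the size drops by 2.
    set E' := (List.ofFn fun i => (ts i, us i)) ++ E with hE'
    have hiff : ∀ η, Unifies η E' ↔ Unifies η ((.func f ts, .func f us) :: E) := by
      intro η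
      rw [unifies_cons]
      simp only [Unifies, hE', List.mem_append, List.mem_ofFn, Term.subst, Term.func.injEq,
        heq_eq_eq, true_and]
      constructor
      · exact fun h => ⟨funext fun i => h _ (Or.inl ⟨i, rfl⟩), fun e he => h e (Or.inr he)⟩
      · rintro ⟨h1, h2⟩ e (⟨i, rfl⟩ | he)
        · exact congrFun h1 i
        · exact h2 e he
    have hv : listVars E' ⊆ listVars ((.func f ts, .func f us) :: E) := by
      intro k hk
      obtain ⟨e, he, h⟩ := mem_listVars.1 hk
      rw [hE', List.mem_append, List.mem_ofFn] at he
      rw [mem_listVars]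
      rcases he with ⟨i, rfl⟩ | he
      · exact ⟨_, List.mem_cons_self, h.imp (fun h => mem_termVars_func.2 ⟨i, h⟩)
          fun h => mem_termVars_func.2 ⟨i, h⟩⟩
      · exact ⟨e, List.mem_cons_of_mem _ he, h⟩
    have hs : listSize E' + 2 = listSize ((.func f ts, .func f us) :: E) := by
      simp only [listSize, hE', List.map_append, List.sum_append, List.map_ofFn, List.sum_ofFn,
        List.map_cons, List.sum_cons, termSize, Function.comp_def, Finset.sum_add_distrib]
      ring
    obtain ⟨θ, hθ⟩ := ihm (listSize E') (by omega) E' ((Finset.card_le_card hv).trans hn) le_rfl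
      ⟨η, (hiff η).2 hη⟩
    exact ⟨θ, hθ.congr hiff⟩

/-- Unifiable terms have a principal unifier. -/
theorem exists_isMGU {a b : L.Term ℕ} {η : ℕ → L.Term ℕ} (h : a.subst η = b.subst η) :
    ∃ θ, IsMGU θ a b := by
  obtain ⟨θ, h1, h2⟩ := exists_listMGU_aux _ _ [(a, b)] le_rfl le_rfl
    ⟨η, unifies_cons.2 ⟨h, by simp [Unifies]⟩⟩
  exact ⟨θ, (unifies_cons.1 h1).1, fun η hη => h2 η (unifies_cons.2 ⟨hη, by simp [Unifies]⟩)⟩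

/-- A finite set of variables can be renamed away from another one. -/
theorem exists_perm_disjoint (A B : Finset ℕ) :
    ∃ π : Equiv.Perm ℕ, ∀ a ∈ A, π a ∉ B := by
  obtain ⟨N, hN⟩ : ∃ N, ∀ a ∈ A ∪ B, a < N :=
    ⟨(A ∪ B).sup id + 1, fun a ha => Nat.lt_succ_of_le (Finset.le_sup (f := id) ha)⟩
  -- The permutation exchanges the blocks [0, N) and [N, 2N).
  have hinv : Function.Involutive
      (fun n => if n < N then n + N else if n < 2 * N then n - N else n) := by
    intro n
    dsimp only
    split_ifs <;> omega
  refine ⟨hinv.toPerm, fun a ha hb => ?_⟩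
  have h1 := hN a (Finset.mem_union_left _ ha)
  have h2 := hN _ (Finset.mem_union_right _ hb)
  simp [h1] at h2

/-- Flows whose inner terms have a common instance have a composition. -/
theorem FlowClass.exists_isComp (F G : Flow L) {s s' : ℕ → L.Term ℕ}
    (h : F.t.subst s = G.u.subst s') :
    ∃ H, FlowClass.IsComp (Quotient.mk _ F) (Quotient.mk _ G) H := by
  obtain ⟨π, hπ⟩ := exists_perm_disjoint F.t.varFinset G.u.varFinset
  have hv : ∀ t : L.Term ℕ, ∀ n, n ∈ (t.relabel π).varFinset ↔ π.symm n ∈ t.varFinset := by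
    intro t n
    rw [mem_varFinset_iff, mem_termVars_relabel, mem_varFinset_iff]
    exact ⟨by rintro ⟨a, ha, rfl⟩; simpa using ha, fun h => ⟨_, h, by simp⟩⟩
  set f : Flow L := ⟨F.u.relabel π, F.t.relabel π, by ext n; rw [hv, hv, F.vars_eq]⟩ with hf
  have hff : (Quotient.mk _ f : FlowClass L) = Quotient.mk _ F :=
    Quotient.sound (Setoid.symm ⟨π, rfl, rfl⟩)
  have hd : Disjoint f.t.varFinset G.u.varFinset := by
    rw [Finset.disjoint_left]
    intro n hn
    have := hπ _ ((hv _ _).1 hn)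
    simpa using this
  classical
  -- As the variables are now disjoint, `s'` and the renamed `s` glue to a single unifier.
  obtain ⟨θ, hθ⟩ := exists_isMGU (a := f.t) (b := G.u)
    (η := fun n => if n ∈ G.u.varFinset then s' n else s (π.symm n)) (by
      have h1 : f.t.subst (fun n => if n ∈ G.u.varFinset then s' n else s (π.symm n)) =
          f.t.subst (fun n => s (π.symm n)) := by
        refine subst_congr _ fun a ha => if_neg ?_
        exact Finset.disjoint_left.1 hd ((mem_varFinset_iff _ _).2 ha)
      have h2 : G.u.subst (fun n => if n ∈ G.u.varFinset then s' n else s (π.symm n)) =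
          G.u.subst s' := subst_congr _ fun a ha => if_pos ((mem_varFinset_iff _ _).2 ha)
      rw [h1, h2, ← h, hf, relabel_subst]
      simp)
  have hvars : (f.u.subst θ).varFinset = (G.t.subst θ).varFinset := by
    have e1 : ∀ n, n ∈ termVars f.u ↔ n ∈ termVars f.t := fun n => by
      rw [← mem_varFinset_iff, f.vars_eq, mem_varFinset_iff]
    have e2 : ∀ n, n ∈ termVars G.u ↔ n ∈ termVars G.t := fun n => by
      rw [← mem_varFinset_iff, G.vars_eq, mem_varFinset_iff]
    ext n
    rw [mem_varFinset_iff, mem_varFinset_iff, mem_termVars_subst, mem_termVars_subst]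
    simp only [e1, ← e2]
    rw [← mem_termVars_subst, hθ.1, mem_termVars_subst]
  exact ⟨Quotient.mk _ ⟨_, _, hvars⟩, f, G, ⟨_, _, hvars⟩, hff, rfl, rfl, hd, θ, hθ, rfl, rfl⟩


/-! ### Free structures and the partial maps of flows -/

/-- The function symbols act on `X` as free constructors. -/
class FreeConstructors (L : FirstOrder.Language.{u, v}) (X : Type w) [L.Structure X] : Prop where
  inj : ∀ {n m : ℕ} (f : L.Functions n) (g : L.Functions m) (a : Fin n → X) (b : Fin m → X),
    Structure.funMap f a = Structure.funMap g b →
      (⟨n, f, a⟩ : Σ n, L.Functions n × (Fin n → X)) = ⟨m, g, b⟩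

section Rep

variable {X : Type w} [L.Structure X]

/-- This makes `Flow.map` independent of the assignment chosen in its definition. -/
theorem realize_inj [FreeConstructors L X] {α : Type*} (t : L.Term α) {S S' : α → X}
    (h : t.realize S = t.realize S') : ∀ a ∈ termVars t, S a = S' a := by
  induction t with
  | var b => rintro a rfl; exact h
  | func f ts ih =>
    intro a ha
    obtain ⟨i, hi⟩ := mem_termVars_func.1 ha
    have := FreeConstructors.inj _ _ _ _ h
    simp only [Sigma.mk.injEq, heq_eq_eq, Prod.mk.injEq, true_and] at this
    exact ih i (congrFun this i) a hi

end Rep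

section Rep

variable {X : Type u} [L.Structure X]

theorem Flow.mem_termVars_iff (F : Flow L) (n : ℕ) : n ∈ termVars F.u ↔ n ∈ termVars F.t := by
  rw [← mem_varFinset_iff, F.vars_eq, mem_varFinset_iff]

theorem Flow.map_of_notMem (F : Flow L) {x : X} (hx : x ∉ openTerm X F.t) : F.map x = x :=
  dif_neg hx

/-- The two sides of a renaming have the same instances. -/
theorem openTerm_relabel (π : Equiv.Perm ℕ) (t : L.Term ℕ) :
    openTerm X (t.relabel π) = openTerm X t := by
  ext x
  constructor
  · rintro ⟨S, rfl⟩
    exact ⟨S ∘ π, by simp⟩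
  · rintro ⟨S, rfl⟩
    exact ⟨S ∘ π.symm, by simp [Function.comp_assoc]⟩

open Classical in
/-- The value of the partial map of a flow, as a formal combination of points. -/
def Flow.ket (F : Flow L) (x : X) : X →₀ ℤ :=
  if x ∈ openTerm X F.t then Finsupp.single (F.map x) 1 else 0

theorem Flow.ket_nonneg (F : Flow L) (x y : X) : 0 ≤ F.ket x y := by
  classical
  unfold Flow.ket
  split_ifs
  · rw [Finsupp.single_apply]; split_ifs <;> simp
  · simp

variable [FreeConstructors L X]

theorem Flow.map_realize (F : Flow L) (S : ℕ → X) : F.map (F.t.realize S) = F.u.realize S := by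
  have h : ∃ T : ℕ → X, F.t.realize T = F.t.realize S := ⟨S, rfl⟩
  rw [Flow.map, dif_pos h]
  exact realize_congr _ fun a ha => realize_inj _ h.choose_spec a ((F.mem_termVars_iff a).1 ha)

theorem Flow.map_mem (F : Flow L) {x : X} (hx : x ∈ openTerm X F.t) : F.map x ∈ openTerm X F.u := by
  obtain ⟨S, rfl⟩ := hx
  exact ⟨S, (F.map_realize S).symm⟩

theorem Flow.adj_map_map (F : Flow L) {x : X} (hx : x ∈ openTerm X F.t) :
    F.adj.map (F.map x) = x := by
  obtain ⟨S, rfl⟩ := hx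
  rw [F.map_realize]
  exact F.adj.map_realize S

theorem Flow.map_injOn (F : Flow L) : Set.InjOn F.map (openTerm X F.t) := fun x hx y hy h => by
  rw [← F.adj_map_map hx, h, F.adj_map_map hy]

theorem Flow.image_map (F : Flow L) : F.map '' openTerm X F.t = openTerm X F.u := by
  refine Set.Subset.antisymm (Set.image_subset_iff.2 fun x hx => F.map_mem hx) fun y hy => ?_
  exact ⟨F.adj.map y, Flow.map_mem F.adj hy, F.adj.adj_map_map hy⟩

theorem Flow.ket_congr {F G : Flow L} (h : F ≈ G) (x : X) : F.ket x = G.ket x := by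
  obtain ⟨π, h1, h2⟩ := h
  have ho : openTerm X G.t = openTerm X F.t := by rw [← h2, openTerm_relabel]
  unfold Flow.ket
  rw [ho]
  split_ifs with hx
  · obtain ⟨S, rfl⟩ := hx
    have : F.t.realize S = G.t.realize (S ∘ π.symm) := by
      rw [← h2]
      simp [Function.comp_assoc]
    dsimp only
    rw [F.map_realize, this, G.map_realize, ← h1]
    simp [Function.comp_assoc]
  · rfl

/-- The value of the partial map of a flow up to renaming. -/
def FlowClass.ket (F : FlowClass L) (x : X) : X →₀ ℤ :=
  Quotient.lift (fun F : Flow L => F.ket x) (fun _ _ h => Flow.ket_congr h x) F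

/-- The action of the unification algebra on points. -/
def UAlg.ket (x : X) : UAlg L →+ (X →₀ ℤ) :=
  (Finsupp.liftAddHom (M := ℤ) fun F : FlowClass L => zmultiplesHom (X →₀ ℤ) (F.ket x) :
    (FlowClass L →₀ ℤ) →+ (X →₀ ℤ))

theorem UAlg.ket_of (F : FlowClass L) (x : X) : UAlg.ket x (UAlg.of F) = F.ket x := by
  have : UAlg.ket x (UAlg.of F) =
    (Finsupp.liftAddHom (M := ℤ) fun F : FlowClass L => zmultiplesHom (X →₀ ℤ) (F.ket x))
      (Finsupp.single F 1) := rfl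
  rw [this, Finsupp.liftAddHom_apply_single]
  simp

/-- The linear extension of the action on points. -/
def UAlg.op (a : UAlg L) : (X →₀ ℤ) →+ (X →₀ ℤ) :=
  Finsupp.liftAddHom fun x => zmultiplesHom (X →₀ ℤ) (UAlg.ket x a)

theorem UAlg.op_single (a : UAlg L) (x : X) : a.op (Finsupp.single x 1) = UAlg.ket x a := by
  simp [UAlg.op]

theorem UAlg.op_apply (a : UAlg L) (v : X →₀ ℤ) :
    a.op v = v.sum fun x n => n • UAlg.ket x a := by
  rw [UAlg.op, Finsupp.liftAddHom_apply]
  rfl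

end Rep

/-! ### The unification algebra -/

namespace UAlg

theorem induction_on {p : UAlg L → Prop} (a : UAlg L) (h0 : p 0)
    (hof : ∀ F, p (of F)) (hneg : ∀ a, p a → p (-a)) (hadd : ∀ a b, p a → p b → p (a + b)) : p a := by
  have hs : ∀ (F : FlowClass L) (n : ℤ), p (Finsupp.single F n : FlowClass L →₀ ℤ) := by
    intro F n
    induction n using Int.induction_on with
    | zero => rw [Finsupp.single_zero]; exact h0
    | succ n ih => rw [Finsupp.single_add]; exact hadd _ _ ih (hof F)
    | pred n ih =>
      rw [sub_eq_add_neg, Finsupp.single_add, Finsupp.single_neg F 1]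
      exact hadd _ _ ih (hneg _ (hof F))
  exact Finsupp.induction_linear (motive := p) a h0 (fun f g => hadd f g) hs

theorem mul_def (a b : UAlg L) : a * b = Finsupp.sum (M := ℤ) a fun F m =>
    Finsupp.sum (M := ℤ) b fun G n => (m * n) • FlowClass.comp F G := rfl

theorem sum_sum_add_left {ι A : Type*} [AddCommGroup A] (c : ι → ι → A) (a b d : ι →₀ ℤ) :
    ((a + b).sum fun F m => d.sum fun G n => (m * n) • c F G) =
      (a.sum fun F m => d.sum fun G n => (m * n) • c F G) +
        b.sum fun F m => d.sum fun G n => (m * n) • c F G := by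
  refine Finsupp.sum_add_index' (fun F => ?_) fun F m n => ?_
  · simp [Finsupp.sum]
  · simp only [Finsupp.sum, ← Finset.sum_add_distrib, add_mul, add_smul]

theorem sum_sum_add_right {ι A : Type*} [AddCommGroup A] (c : ι → ι → A) (a b d : ι →₀ ℤ) :
    (a.sum fun F m => (b + d).sum fun G n => (m * n) • c F G) =
      (a.sum fun F m => b.sum fun G n => (m * n) • c F G) +
        a.sum fun F m => d.sum fun G n => (m * n) • c F G := by
  rw [← Finsupp.sum_add]
  refine Finsupp.sum_congr fun F _ => ?_
  refine Finsupp.sum_add_index' (fun G => ?_) fun G m n => ?_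
  · simp
  · simp only [mul_add, add_smul]

protected theorem add_mul (a b c : UAlg L) : (a + b) * c = a * c + b * c :=
  sum_sum_add_left FlowClass.comp (ι := FlowClass L) a b c

protected theorem mul_add (a b c : UAlg L) : a * (b + c) = a * b + a * c :=
  sum_sum_add_right FlowClass.comp (ι := FlowClass L) a b c

protected theorem zero_mul (a : UAlg L) : 0 * a = 0 := by
  have := UAlg.add_mul 0 0 a
  rwa [add_zero, left_eq_add] at this

protected theorem mul_zero (a : UAlg L) : a * 0 = 0 := by
  have := UAlg.mul_add a 0 0
  rwa [add_zero, left_eq_add] at this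

protected theorem neg_mul (a b : UAlg L) : -a * b = -(a * b) := by
  rw [eq_neg_iff_add_eq_zero, ← UAlg.add_mul, neg_add_cancel, UAlg.zero_mul]

protected theorem mul_neg (a b : UAlg L) : a * -b = -(a * b) := by
  rw [eq_neg_iff_add_eq_zero, ← UAlg.mul_add, neg_add_cancel, UAlg.mul_zero]

theorem of_mul_of (F G : FlowClass L) : of F * of G = FlowClass.comp F G := by
  rw [mul_def]
  unfold of
  rw [Finsupp.sum_single_index (M := ℤ), Finsupp.sum_single_index (M := ℤ)] <;> simp

/-- Powers are nested to the left and start from 1. Associativity is not established in the algebra: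
products are compared through their action on good points. -/
theorem pow_succ' (a : UAlg L) (n : ℕ) : a ^ (n + 1) = a ^ n * a := rfl

/-- The sums of flows. -/
def cone (L : FirstOrder.Language.{u, v}) : AddSubmonoid (UAlg L) :=
  AddSubmonoid.closure (Set.range of)

theorem of_mem_cone (F : FlowClass L) : of F ∈ cone L :=
  AddSubmonoid.subset_closure ⟨F, rfl⟩

theorem toAlg_mem_cone (W : Wiring L) : W.toAlg ∈ cone L := by
  refine AddSubmonoid.list_sum_mem _ fun a ha => ?_
  obtain ⟨F, _, rfl⟩ := List.mem_map.1 ha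
  exact of_mem_cone _

theorem one_mem_cone : (1 : UAlg L) ∈ cone L := of_mem_cone _

theorem mul_mem_cone {a b : UAlg L} (ha : a ∈ cone L) (hb : b ∈ cone L) : a * b ∈ cone L := by
  refine AddSubmonoid.closure_induction₂ (motive := fun a b _ _ => a * b ∈ cone L)
    ?_ ?_ ?_ ?_ ?_ ha hb
  · rintro _ _ ⟨F, rfl⟩ ⟨G, rfl⟩
    rw [of_mul_of, FlowClass.comp]
    split_ifs
    · exact of_mem_cone _
    · exact zero_mem _
  · intro x _; rw [UAlg.zero_mul]; exact zero_mem _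
  · intro x _; rw [UAlg.mul_zero]; exact zero_mem _
  · intro x y z _ _ _ h1 h2; rw [UAlg.add_mul]; exact add_mem h1 h2
  · intro x y z _ _ _ h1 h2; rw [UAlg.mul_add]; exact add_mem h1 h2

theorem pow_mem_cone {a : UAlg L} (ha : a ∈ cone L) (n : ℕ) : a ^ n ∈ cone L := by
  induction n with
  | zero => exact one_mem_cone
  | succ n ih => exact mul_mem_cone ih ha

section

variable {X : Type u} [L.Structure X] [FreeConstructors L X]

theorem ket_one (x : X) : ket x (1 : UAlg L) = Finsupp.single x 1 := by
  have : ket x (1 : UAlg L) = Flow.ket (L := L) ⟨.var 0, .var 0, rfl⟩ x := ket_of _ _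
  rw [this, Flow.ket, if_pos ⟨fun _ => x, rfl⟩]
  congr 1
  exact Flow.map_realize (L := L) ⟨.var 0, .var 0, rfl⟩ fun _ => x

theorem ket_nonneg {a : UAlg L} (ha : a ∈ cone L) (x y : X) : 0 ≤ ket x a y := by
  refine AddSubmonoid.closure_induction (motive := fun a _ => 0 ≤ ket x a y) ?_ ?_ ?_ ha
  · rintro _ ⟨F, rfl⟩
    rw [ket_of]
    induction F using Quotient.inductionOn with
    | h F => exact Flow.ket_nonneg F x y
  · simp
  · intro a b _ _ h1 h2
    rw [map_add, Finsupp.add_apply]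
    exact add_nonneg h1 h2

/-- The adjoint flow is the inverse partial injection, so the adjoint acts by the transposed matrix.
-/
theorem ket_adj (a : UAlg L) (x y : X) : ket x a.adj y = ket y a x := by
  have hadd : ∀ a b : UAlg L, (a + b).adj = a.adj + b.adj := fun a b =>
    Finsupp.mapDomain_add (M := ℤ)
  have hof : ∀ F : FlowClass L, (of F).adj = of F.adj := fun F =>
    Finsupp.mapDomain_single (M := ℤ)
  have h0 : (0 : UAlg L).adj = 0 := Finsupp.mapDomain_zero (M := ℤ)
  refine induction_on (p := fun a : UAlg L => ket x a.adj y = ket y a x) a ?_ ?_ ?_ ?_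
  · simp [h0]
  · intro F
    rw [hof, ket_of, ket_of]
    induction F using Quotient.inductionOn with
    | h F =>
      change F.adj.ket x y = F.ket y x
      classical
      unfold Flow.ket
      by_cases h1 : x ∈ openTerm X F.adj.t
      · rw [if_pos h1, Finsupp.single_apply]
        split_ifs with h2 h3 h3
        · have : F.map y = x := by rw [← h2]; exact F.adj.adj_map_map h1
          simp [this]
        · exact absurd (h2 ▸ F.adj.map_mem h1) h3
        · rw [Finsupp.single_apply, if_neg]
          exact fun h => h2 (by rw [← h]; exact F.adj_map_map h3)
        · simp
      · rw [if_neg h1]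
        split_ifs with h3
        · rw [Finsupp.single_apply, if_neg]
          · simp
          · exact fun h => h1 (by rw [← h]; exact F.map_mem h3)
        · simp
  · intro a h
    have : (-a).adj = -a.adj := by
      rw [eq_neg_iff_add_eq_zero, ← hadd, neg_add_cancel, h0]
    simp [this, h]
  · intro a b h1 h2
    simp [hadd, h1, h2]

end

end UAlg

/-! ### The representation on good points -/

/-- A set of points on which composition of flows is computed by unification. -/
structure IsUnifying (L : FirstOrder.Language.{u, v}) {X : Type u} [L.Structure X]
    (good : X → Prop) : Prop where
  common_instance : ∀ x, good x → ∀ t t' : L.Term ℕ, x ∈ openTerm X t → x ∈ openTerm X t' →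
    ∃ (w : L.Term ℕ) (s s' : ℕ → L.Term ℕ), w = t.subst s ∧ w = t'.subst s' ∧ x ∈ openTerm X w
  map : ∀ F : Flow L, ∀ x, good x → x ∈ openTerm X F.t → good (F.map x)
  exists_mem : ∀ t : L.Term ℕ, ∃ x ∈ openTerm X t, good x

namespace UAlg

variable {X : Type u} [L.Structure X] [FreeConstructors L X] {good : X → Prop}

/-- Combinations of good points. -/
def goodSpan (good : X → Prop) : AddSubgroup (X →₀ ℤ) :=
  AddSubgroup.closure ((fun x => Finsupp.single x 1) '' {x | good x})

theorem single_mem_goodSpan {x : X} (hx : good x) : Finsupp.single x 1 ∈ goodSpan good :=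
  AddSubgroup.subset_closure ⟨x, hx, rfl⟩

theorem good_of_mem_goodSpan {v : X →₀ ℤ} (hv : v ∈ goodSpan good) {y : X} (hy : v y ≠ 0) :
    good y := by
  classical
  by_contra h
  apply hy
  refine AddSubgroup.closure_induction (p := fun v _ => v y = 0) ?_ ?_ ?_ ?_ hv
  · rintro _ ⟨x, hx, rfl⟩
    dsimp only
    rw [Finsupp.single_apply, if_neg]
    rintro rfl
    exact h hx
  · rfl
  · intro a b _ _ h1 h2; simp [h1, h2]
  · intro a _ h1; simp [h1]

/-- Composition of flows is composition of partial maps at good points. -/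
theorem ket_comp (hg : IsUnifying L good) (F G : Flow L) {x : X} (hx : good x) :
    ket x (FlowClass.comp (Quotient.mk _ F) (Quotient.mk _ G)) =
      (of (Quotient.mk _ F)).op (G.ket x) := by
  have hop : ∀ y : X, (of (Quotient.mk _ F)).op (Finsupp.single y 1) = F.ket y := fun y => by
    rw [op_single, ket_of]; rfl
  by_cases hH : ∃ H, FlowClass.IsComp (Quotient.mk _ F) (Quotient.mk _ G) H
  · rw [FlowClass.comp, dif_pos hH, ket_of]
    obtain ⟨f, g, h, hf, hg', hh, hd, θ, hθ, hu, ht⟩ := hH.choose_spec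
    have hop : ∀ y : X, (of (Quotient.mk _ F)).op (Finsupp.single y 1) = f.ket y := fun y => by
      rw [hop]; exact Flow.ket_congr (Setoid.symm (Quotient.exact hf)) y
    rw [← hh]
    change h.ket x = _
    rw [← Flow.ket_congr (Quotient.exact hg') x]
    by_cases h1 : x ∈ openTerm X g.t
    · rw [Flow.ket.eq_1 g, if_pos h1, hop]
      by_cases h2 : g.map x ∈ openTerm X f.t
      · obtain ⟨w, s, s', hw, hw', R, hR⟩ := hg.common_instance _ (hg.map g x hx h1) f.t g.u h2
          (g.map_mem h1)
        -- The common instance at the point gives a unifier, hence a factorisation through θ.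
        -- Evaluating ρ at R then exhibits the intermediate point as an instance of the unified
        -- term.
        obtain ⟨ρ, hρ⟩ := hθ.2 (fun n => if n ∈ g.u.varFinset then s' n else s n) (by
          have e1 : f.t.subst (fun n => if n ∈ g.u.varFinset then s' n else s n) =
              f.t.subst s := by
            refine subst_congr _ fun a ha => if_neg ?_
            exact Finset.disjoint_left.1 hd ((mem_varFinset_iff f.t a).2 ha)
          have e2 : g.u.subst (fun n => if n ∈ g.u.varFinset then s' n else s n) =
              g.u.subst s' := subst_congr _ fun a ha => if_pos ((mem_varFinset_iff _ _).2 ha)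
          rw [e1, e2, ← hw, ← hw'])
        set T : ℕ → X := fun n => (ρ n).realize R with hT
        have hθT : ∀ t : L.Term ℕ, (t.subst θ).realize T =
            (t.subst fun n => if n ∈ g.u.varFinset then s' n else s n).realize R := by
          intro t
          have : (t.subst fun n => if n ∈ g.u.varFinset then s' n else s n) =
              (t.subst θ).subst ρ := by
            rw [subst_subst]; exact subst_congr _ fun a _ => hρ a
          rw [this, Term.realize_subst (tf := ρ)]
        have hgx : g.map x = (g.u.subst θ).realize T := by
          rw [hθT, ← hR, hw']
          dsimp only
          congr 1
          exact subst_congr _ fun a ha => (if_pos ((mem_varFinset_iff g.u a).2 ha)).symm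
        have hx' : x = h.t.realize T := by
          rw [← g.adj_map_map h1, hgx, ht, Term.realize_subst, Term.realize_subst]
          exact g.adj.map_realize _
        have hfx : f.map (g.map x) = h.map x := by
          conv_rhs => rw [hx', h.map_realize, hu, Term.realize_subst]
          rw [hgx, ← hθ.1, Term.realize_subst, f.map_realize]
        rw [Flow.ket, if_pos ⟨T, hx'.symm⟩, Flow.ket, if_pos h2, hfx]
      · rw [Flow.ket, Flow.ket, if_neg h2, if_neg]
        rintro ⟨T, rfl⟩
        apply h2
        dsimp only
        rw [ht, Term.realize_subst, g.map_realize, ← Term.realize_subst, ← hθ.1,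
          Term.realize_subst]
        exact ⟨_, rfl⟩
    · rw [Flow.ket.eq_1 g, if_neg h1, map_zero, Flow.ket, if_neg]
      rintro ⟨T, rfl⟩
      apply h1
      dsimp only
      rw [ht, Term.realize_subst]
      exact ⟨_, rfl⟩
  -- Without a composition the partial maps cannot be chained at x either: a good intermediate point
  -- would provide a unifier.
  · rw [FlowClass.comp, dif_neg hH, map_zero]
    by_cases h1 : x ∈ openTerm X G.t
    · rw [Flow.ket, if_pos h1, hop, Flow.ket, if_neg]
      intro h2
      obtain ⟨w, s, s', hw, hw', -⟩ := hg.common_instance _ (hg.map G x hx h1) F.t G.u h2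
        (G.map_mem h1)
      exact hH (FlowClass.exists_isComp F G (hw ▸ hw'))
    · rw [Flow.ket, if_neg h1, map_zero]

theorem ket_mem (hg : IsUnifying L good) (a : UAlg L) {x : X} (hx : good x) :
    ket x a ∈ goodSpan good := by
  refine induction_on (p := fun a : UAlg L => ket x a ∈ goodSpan good) a ?_ ?_ ?_ ?_
  · rw [map_zero]; exact zero_mem _
  · intro F
    rw [ket_of]
    induction F using Quotient.inductionOn with
    | h F =>
      change F.ket x ∈ _
      unfold Flow.ket
      split_ifs with h
      · exact single_mem_goodSpan (hg.map F x hx h)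
      · exact zero_mem _
  · intro a h; rw [map_neg]; exact neg_mem h
  · intro a b h1 h2; rw [map_add]; exact add_mem h1 h2

theorem op_mem (hg : IsUnifying L good) (a : UAlg L) {v : X →₀ ℤ} (hv : v ∈ goodSpan good) :
    a.op v ∈ goodSpan good := by
  refine AddSubgroup.closure_induction (p := fun v _ => a.op v ∈ goodSpan good) ?_ ?_ ?_ ?_ hv
  · rintro _ ⟨x, hx, rfl⟩
    rw [op_single]
    exact ket_mem hg a hx
  · rw [map_zero]; exact zero_mem _
  · intro v w _ _ h1 h2; rw [map_add]; exact add_mem h1 h2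
  · intro v _ h; rw [map_neg]; exact neg_mem h

theorem hom_eq_of_goodSpan {A : Type*} [AddGroup A] {φ ψ : (X →₀ ℤ) →+ A}
    (h : ∀ x, good x → φ (Finsupp.single x 1) = ψ (Finsupp.single x 1)) {v : X →₀ ℤ}
    (hv : v ∈ goodSpan good) : φ v = ψ v := by
  refine AddMonoidHom.eqOn_closure (f := φ) (g := ψ) ?_ hv
  rintro _ ⟨x, hx, rfl⟩
  exact h x hx

theorem op_add (a b : UAlg L) (v : X →₀ ℤ) : (a + b).op v = a.op v + b.op v := by
  simp only [op_apply, map_add, smul_add, Finsupp.sum_add]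

theorem op_neg (a : UAlg L) (v : X →₀ ℤ) : (-a).op v = -a.op v := by
  simp only [op_apply, map_neg, smul_neg, Finsupp.sum_neg]

theorem op_zero (v : X →₀ ℤ) : (0 : UAlg L).op v = 0 := by
  simp [op_apply]

theorem op_sub (a b : UAlg L) (v : X →₀ ℤ) : (a - b).op v = a.op v - b.op v := by
  rw [sub_eq_add_neg, op_add, op_neg, sub_eq_add_neg]

theorem op_one (v : X →₀ ℤ) : (1 : UAlg L).op v = v := by
  rw [op_apply]
  simp [ket_one]

theorem ket_mul (hg : IsUnifying L good) (a b : UAlg L) {x : X} (hx : good x) :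
    ket x (a * b) = a.op (ket x b) := by
  refine induction_on (p := fun a : UAlg L => ket x (a * b) = a.op (ket x b)) a ?_ ?_ ?_ ?_
  · rw [UAlg.zero_mul, op_zero, map_zero]
  · intro F
    refine induction_on (p := fun b : UAlg L => ket x (of F * b) = (of F).op (ket x b)) b ?_ ?_ ?_ ?_
    · rw [UAlg.mul_zero, map_zero, map_zero]
    · intro G
      rw [of_mul_of, ket_of]
      induction F using Quotient.inductionOn with
      | h F =>
      induction G using Quotient.inductionOn with
      | h G => exact ket_comp hg F G hx
    · intro b h; rw [UAlg.mul_neg, map_neg, map_neg, map_neg, h]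
    · intro b c h1 h2; rw [UAlg.mul_add, map_add, map_add, map_add, h1, h2]
  · intro a h; rw [UAlg.neg_mul, map_neg, h, op_neg]
  · intro b c h1 h2; rw [UAlg.add_mul, map_add, h1, h2, op_add]

theorem op_mul (hg : IsUnifying L good) (a b : UAlg L) {v : X →₀ ℤ} (hv : v ∈ goodSpan good) :
    (a * b).op v = a.op (b.op v) := by
  refine hom_eq_of_goodSpan (φ := (a * b).op) (ψ := a.op.comp b.op) (fun x hx => ?_) hv
  rw [AddMonoidHom.comp_apply, op_single, op_single, ket_mul hg a b hx]

theorem op_pow (hg : IsUnifying L good) (a : UAlg L) (n : ℕ) {v : X →₀ ℤ}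
    (hv : v ∈ goodSpan good) : (a ^ n).op v = a.op^[n] v := by
  induction n generalizing v with
  | zero => exact op_one v
  | succ n ih => rw [pow_succ', op_mul hg _ _ hv, ih (op_mem hg a hv), Function.iterate_succ_apply]

/-- In a sum of flows all matrix entries are nonnegative, so nothing cancels, and each flow is
nonzero at some good point of its source. -/
theorem eq_zero_of_ket (hg : IsUnifying L good) {a : UAlg L} (ha : a ∈ cone L)
    (h : ∀ x : X, good x → ket x a = 0) : a = 0 := by
  have : a = 0 ∨ ∃ x y : X, good x ∧ 0 < ket x a y := by
    refine AddSubmonoid.closure_induction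
      (motive := fun a _ => a = 0 ∨ ∃ x y : X, good x ∧ 0 < ket x a y) ?_ ?_ ?_ ha
    · rintro _ ⟨F, rfl⟩
      induction F using Quotient.inductionOn with
      | h F =>
        obtain ⟨x, hx, hgx⟩ := hg.exists_mem F.t
        refine Or.inr ⟨x, F.map x, hgx, ?_⟩
        rw [ket_of]
        change 0 < F.ket x _
        rw [Flow.ket, if_pos hx, Finsupp.single_eq_same]
        exact one_pos
    · exact Or.inl rfl
    · rintro a b ha hb (rfl | ⟨x, y, hx, h1⟩) h2
      · rwa [zero_add]
      · refine Or.inr ⟨x, y, hx, ?_⟩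
        rw [map_add, Finsupp.add_apply]
        exact add_pos_of_pos_of_nonneg h1 (ket_nonneg hb x y)
  rcases this with h0 | ⟨x, y, hx, hxy⟩
  · exact h0
  · rw [h x hx] at hxy
    exact absurd hxy (lt_irrefl _)

end UAlg

/-! ### The execution formula on points -/

namespace UAlg

variable {X : Type u} [L.Structure X] [FreeConstructors L X] {good : X → Prop}

theorem ket_toAlg (W : Wiring L) (x : X) :
    ket x W.toAlg = ∑ i : Fin W.length, (W.get i).ket x := by
  rw [Wiring.toAlg, map_list_sum, List.map_map]
  conv_lhs => rw [← List.ofFn_get W, List.map_ofFn, List.sum_ofFn]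
  exact Finset.sum_congr rfl fun i _ => ket_of _ _

theorem ket_toAlg_eq_zero {W : Wiring L} {x : X} (h : ket x W.toAlg = 0) {F : Flow L} (hF : F ∈ W) :
    x ∉ openTerm X F.t := by
  intro hx
  obtain ⟨i, hi, rfl⟩ := List.mem_iff_getElem.1 hF
  have h1 := DFunLike.congr_fun h ((W[i]).map x)
  rw [ket_toAlg, Finsupp.finsetSum_apply, Finsupp.zero_apply,
    Finset.sum_eq_zero_iff_of_nonneg fun i _ => Flow.ket_nonneg _ _ _] at h1
  have h2 := h1 ⟨i, hi⟩ (Finset.mem_univ _)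
  simp only [List.get_eq_getElem] at h2
  rw [Flow.ket, if_pos hx, Finsupp.single_eq_same] at h2
  exact one_ne_zero h2

theorem op_apply_apply (a : UAlg L) (v : X →₀ ℤ) {S : Finset X} (hS : v.support ⊆ S) (z : X) :
    a.op v z = ∑ w ∈ S, v w * ket w a z := by
  rw [op_apply, Finsupp.sum_of_support_subset v hS _ (by simp), Finsupp.finsetSum_apply]
  simp

theorem op_sq (hg : IsUnifying L good) (a : UAlg L) {v : X →₀ ℤ} (hv : v ∈ goodSpan good) :
    (a ^ 2).op v = a.op (a.op v) := op_pow hg a 2 hv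

theorem ket_sq (hg : IsUnifying L good) (a : UAlg L) {x : X} (hx : good x) :
    ket x (a ^ 2) = a.op (ket x a) := by
  rw [← op_single, op_sq hg a (single_mem_goodSpan hx), op_single]

/-- The square of a partial symmetry is the diagonal projection on its support. -/
theorem ket_sq_of_isPartialSymmetry (hg : IsUnifying L good) {σ : UAlg L} (hadj : σ.adj = σ) (hproj : σ ^ 2 * σ ^ 2 = σ ^ 2) {x : X} (hx : good x)
    (h0 : ket x σ ≠ 0) : ket x (σ ^ 2) = Finsupp.single x 1 := by
  classical
  have hsymm : ∀ x y : X, ket x σ y = ket y σ x := fun x y => by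
    conv_lhs => rw [← hadj]
    exact ket_adj σ x y
  have hP : ∀ z, good z → ket x (σ ^ 2) z = ket z (σ ^ 2) x := by
    intro z hz
    rw [ket_sq hg σ hx, ket_sq hg σ hz, op_apply_apply σ _ Finset.subset_union_left,
      op_apply_apply σ _ Finset.subset_union_right]
    refine Finset.sum_congr rfl fun w _ => ?_
    rw [hsymm x w, hsymm w z, mul_comm]
  -- With P the matrix of σ², idempotency and symmetry give P(x,x) = ∑ P(x,z)². Symmetry is only
  -- available at good z, which includes the support of the column.
  have hsum : ket x (σ ^ 2) x = ∑ z ∈ (ket x (σ ^ 2)).support, ket x (σ ^ 2) z ^ 2 := by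
    conv_lhs => rw [← hproj, ket_mul hg _ _ hx, op_apply_apply _ _ subset_rfl]
    refine Finset.sum_congr rfl fun z hz => ?_
    rw [← hP z (good_of_mem_goodSpan (ket_mem hg _ hx) (Finsupp.mem_support_iff.1 hz)), sq]
  have hpos : 0 < ket x (σ ^ 2) x := by
    rw [ket_sq hg σ hx, op_apply_apply _ _ subset_rfl]
    refine Finset.sum_pos (fun w hw => ?_) (Finsupp.support_nonempty_iff.2 h0)
    rw [hsymm w x]
    exact mul_self_pos.2 (Finsupp.mem_support_iff.1 hw)
  have hmem : x ∈ (ket x (σ ^ 2)).support := Finsupp.mem_support_iff.2 hpos.ne'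
  rw [← Finset.add_sum_erase _ _ hmem] at hsum
  have hnn : 0 ≤ ∑ z ∈ (ket x (σ ^ 2)).support.erase x, ket x (σ ^ 2) z ^ 2 :=
    Finset.sum_nonneg fun z _ => sq_nonneg _
  -- A positive integer which is at least its square is 1; this leaves 0 for the sum of the other
  -- squares.
  have hone : ket x (σ ^ 2) x = 1 := by nlinarith
  have hz : ∑ z ∈ (ket x (σ ^ 2)).support.erase x, ket x (σ ^ 2) z ^ 2 = 0 := by
    rw [hone] at hsum; linarith
  rw [Finset.sum_eq_zero_iff_of_nonneg fun z _ => sq_nonneg _] at hz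
  ext y
  rw [Finsupp.single_apply]
  split_ifs with hxy
  · rw [← hxy, hone]
  · by_contra hy
    have := hz y (Finset.mem_erase.2 ⟨fun h => hxy h.symm, Finsupp.mem_support_iff.2 hy⟩)
    exact hy (pow_eq_zero_iff two_ne_zero |>.1 this)

/-- Nonnegativity prevents cancellation at a source point. A target point is a source point of the
adjoint, and σ is hermitian. -/
theorem mem_supp_iff_ket_ne_zero {σ : Wiring L} (hadj : σ.toAlg.adj = σ.toAlg) (x : X) :
    x ∈ σ.supp X ↔ ket x σ.toAlg ≠ 0 := by
  constructor
  · intro hx h0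
    simp only [Wiring.supp, Set.mem_iUnion] at hx
    obtain ⟨F, hF, hx | hx⟩ := hx
    · exact ket_toAlg_eq_zero h0 hF hx
    · obtain ⟨y, hy, rfl⟩ : ∃ y ∈ openTerm X F.t, F.map y = x := by
        rw [← F.image_map] at hx; exact hx
      obtain ⟨i, hi, rfl⟩ := List.mem_iff_getElem.1 hF
      have h1 : ket y σ.toAlg ((σ[i]).map y) = 0 := by
        rw [← ket_adj, hadj, h0]; rfl
      rw [ket_toAlg, Finsupp.finsetSum_apply,
        Finset.sum_eq_zero_iff_of_nonneg fun i _ => Flow.ket_nonneg _ _ _] at h1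
      have h2 := h1 ⟨i, hi⟩ (Finset.mem_univ _)
      simp only [List.get_eq_getElem] at h2
      rw [Flow.ket, if_pos hy, Finsupp.single_eq_same] at h2
      exact one_ne_zero h2
  · intro h
    by_contra hx
    apply h
    rw [ket_toAlg]
    refine Finset.sum_eq_zero fun i _ => ?_
    rw [Flow.ket, if_neg]
    intro hi
    exact hx (Set.mem_iUnion₂.2 ⟨_, List.get_mem σ i, Or.inl hi⟩)

open Classical in
/-- The action of `1 - σ²`. -/
theorem op_one_sub_sq (hg : IsUnifying L good) {σ : Wiring L} (hadj : σ.toAlg.adj = σ.toAlg)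
    (hproj : σ.toAlg ^ 2 * σ.toAlg ^ 2 = σ.toAlg ^ 2) {v : X →₀ ℤ} (hv : v ∈ goodSpan good) :
    (1 - σ.toAlg ^ 2).op v = v.filter (· ∉ σ.supp X) := by
  refine hom_eq_of_goodSpan (φ := (1 - σ.toAlg ^ 2).op)
    (ψ := Finsupp.filterAddHom (M := ℤ) (· ∉ σ.supp X)) (fun x hx => ?_) hv
  change _ = Finsupp.filter _ _
  rw [op_sub, op_one, op_single]
  by_cases h : x ∈ σ.supp X
  · rw [ket_sq_of_isPartialSymmetry hg hadj hproj hx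
      ((mem_supp_iff_ket_ne_zero hadj x).1 h), sub_self,
      Finsupp.filter_single_of_neg (· ∉ σ.supp X) (not_not.2 h)]
  · have h0 := not_not.1 (fun h0 => h ((mem_supp_iff_ket_ne_zero hadj x).2 h0))
    rw [ket_sq hg _ hx, h0, map_zero, sub_zero, Finsupp.filter_single_of_pos (· ∉ σ.supp X) h]

theorem op_alternating (hg : IsUnifying L good) (U σ : UAlg L) (k : ℕ) {v : X →₀ ℤ}
    (hv : v ∈ goodSpan good) :
    (U * (σ * U) ^ k).op v = U.op ((fun w => σ.op (U.op w))^[k] v) := by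
  have h : ∀ (k : ℕ) {v : X →₀ ℤ}, v ∈ goodSpan good →
      ((σ * U) ^ k).op v = (fun w => σ.op (U.op w))^[k] v := by
    intro k
    induction k with
    | zero => intro v _; exact op_one v
    | succ k ih =>
      intro v hv
      rw [pow_succ', op_mul hg _ _ hv, ih (op_mem hg _ hv), op_mul hg _ _ hv,
        Function.iterate_succ_apply]
  rw [op_mul hg _ _ hv, h k hv]

/-- On good points U(σU)ᵏ acts as (Uσ)ᵏU, which contains the factor (Uσ)ⁿ = 0. Faithfulness on sums
of flows then gives vanishing in the algebra itself. -/
theorem alternating_eq_zero (hg : IsUnifying L good) {U σ : UAlg L} (hU : U ∈ cone L)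
    (hσ : σ ∈ cone L) {n : ℕ} (hn : (U * σ) ^ n = 0) {k : ℕ} (hk : n ≤ k) :
    U * (σ * U) ^ k = 0 := by
  refine eq_zero_of_ket hg (mul_mem_cone hU (pow_mem_cone (mul_mem_cone hσ hU) k)) fun x hx => ?_
  have hx' := single_mem_goodSpan hx
  rw [← op_single, op_alternating hg _ _ _ hx']
  have h : ∀ (j : ℕ) {w : X →₀ ℤ}, w ∈ goodSpan good →
      (fun w => U.op (σ.op w))^[j] w = ((U * σ) ^ j).op w := by
    intro j
    induction j with
    | zero => intro w _; exact (op_one w).symm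
    | succ j ih =>
      intro w hw
      rw [Function.iterate_succ_apply, ih (op_mem hg _ (op_mem hg _ hw)), pow_succ',
        op_mul hg _ _ hw, op_mul hg _ _ hw]
  have h2 : U.op ((fun w => σ.op (U.op w))^[k] (Finsupp.single x 1)) =
      (fun w => U.op (σ.op w))^[k] (U.op (Finsupp.single x 1)) :=
    Function.Semiconj.iterate_right (f := U.op) (ga := fun w : X →₀ ℤ => σ.op (U.op w))
      (gb := fun w => U.op (σ.op w)) (fun w => rfl) k _
  rw [h2, ← Nat.sub_add_cancel hk, Function.iterate_add_apply, h n (op_mem hg _ hx'), hn, op_zero]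
  exact Function.iterate_fixed (by simp) _

/-- The finite support has to be checked, since `∑ᶠ` would otherwise take its default value 0. -/
theorem ex_eq_sum (hg : IsUnifying L good) {U σ : UAlg L} (hU : U ∈ cone L)
    (hσ : σ ∈ cone L) {n : ℕ} (hn : (U * σ) ^ n = 0) :
    ex U σ = (1 - σ ^ 2) * (∑ k ∈ Finset.range n, U * (σ * U) ^ k) * (1 - σ ^ 2) := by
  rw [ex, finsum_eq_sum_of_support_subset]
  intro k hk
  rw [Finset.coe_range, Set.mem_Iio]
  by_contra h
  exact hk (alternating_eq_zero hg hU hσ hn (not_lt.1 h))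

-- The right factor 1 - σ² acts first and kills the points of the cut; the left one discards the
-- values in the cut.
open Classical in
theorem ket_ex (hg : IsUnifying L good) {U : UAlg L} {σ : Wiring L} (hU : U ∈ cone L)
    (hadj : σ.toAlg.adj = σ.toAlg) (hproj : σ.toAlg ^ 2 * σ.toAlg ^ 2 = σ.toAlg ^ 2) {n : ℕ}
    (hn : (U * σ.toAlg) ^ n = 0) {x : X} (hx : good x) :
    ket x (ex U σ.toAlg) = if x ∈ σ.supp X then 0 else
      (∑ k ∈ Finset.range n, ket x (U * (σ.toAlg * U) ^ k)).filter (· ∉ σ.supp X) := by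
  rw [ex_eq_sum hg hU (toAlg_mem_cone σ) hn, ket_mul hg _ _ hx, ← op_single (1 - σ.toAlg ^ 2),
    op_one_sub_sq hg hadj hproj (single_mem_goodSpan hx)]
  split_ifs with h
  · rw [Finsupp.filter_single_of_neg (· ∉ σ.supp X) (not_not.2 h), map_zero]
  · rw [Finsupp.filter_single_of_pos (· ∉ σ.supp X) h, op_single, ket_mul hg _ _ hx,
      op_one_sub_sq hg hadj hproj (ket_mem hg _ hx), map_sum]

end UAlg

/-! ### Graphings -/

namespace Graphing

variable {Ω : Type w} {X : Type u}

/-- The codes of the edges of `F` that send `x` to `y`. -/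
def codes (F : Graphing Ω X) (enc : F.E → ℕ) (x y : X) (k : ℕ) : Prop :=
  ∃ f, enc f = k ∧ x ∈ F.src f ∧ F.real f x = y

open Classical in
/-- The number of the edges of `F` with code less than `k` that send `x` to `y`. -/
def rank (F : Graphing Ω X) (enc : F.E → ℕ) (x y : X) (k : ℕ) : ℕ :=
  Nat.count (F.codes enc x y) k

theorem encard_codes (F : Graphing Ω X) {enc : F.E → ℕ} (henc : Function.Injective enc) (x y : X) :
    {k | F.codes enc x y k}.encard = {f | x ∈ F.src f ∧ F.real f x = y}.encard := by
  rw [← henc.encard_image]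
  congr 1
  ext k
  simp only [codes, Set.mem_ofPred_eq, Set.mem_image]
  exact ⟨fun ⟨f, h1, h2⟩ => ⟨f, h2, h1⟩, fun ⟨f, h1, h2⟩ => ⟨f, h2, h1⟩⟩

-- An element is determined by its rank in the set. As both sets have as many elements, finite or
-- not, each rank that occurs in one occurs in the other.
open Classical in
theorem exists_count_eq {p q : ℕ → Prop} (h : {k | p k}.encard = {k | q k}.encard) {n : ℕ}
    (hn : p n) : ∃ m, q m ∧ Nat.count p n = Nat.count q m := by
  have key : ∀ hf : (Set.ofPred q).Finite, Nat.count p n < hf.toFinset.card := by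
    intro hf
    have hp : {k | p k}.Finite := by
      rw [← Set.encard_lt_top_iff, h, Set.encard_lt_top_iff]; exact hf
    rw [hp.encard_eq_coe_toFinset_card, Set.Finite.encard_eq_coe_toFinset_card (s := {k | q k}) hf]
      at h
    rw [← Nat.cast_inj.1 h]
    exact Nat.count_lt_card hp hn
  exact ⟨_, Nat.nth_mem _ key, (Nat.count_nth key).symm⟩

theorem pathReal_injOn {F : Graphing Ω X} (hF : ∀ e, Set.InjOn (F.real e) (F.src e))
    (π : List F.E) : Set.InjOn (F.pathReal π) (F.pathSrc π) := by
  induction π with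
  | nil => exact fun x _ y _ h => h
  | cons e π ih => exact fun x hx y hy h => hF e hx.1 hy.1 (ih hx.2 hy.2 h)

end Graphing

section Graphings

variable {Ω : Type w} {X : Type u} [MeasurableSpace X] {μ : Measure X}

theorem InMacrocosm.id : InMacrocosm μ (id : X → X) :=
  ⟨measurable_id, fun A hA => by rwa [Set.image_id], fun A _ => by rw [Set.image_id]⟩

theorem InMacrocosm.comp {f g : X → X} (hg : InMacrocosm μ g) (hf : InMacrocosm μ f) :
    InMacrocosm μ (g ∘ f) :=
  ⟨hg.measurable.comp hf.measurable,
    fun A hA => by rw [Set.image_comp]; exact hg.image_measurable _ (hf.image_measurable A hA),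
    fun A hA => by
      rw [Set.image_comp, hg.nonsingular _ (hf.image_measurable A hA), hf.nonsingular A hA]⟩

/-- Non-singularity is stated for images. The image of the preimage of a measurable null hull of N
lies in that hull, so the preimage is null as well. -/
theorem InMacrocosm.preimage_null {f : X → X} (hf : InMacrocosm μ f) {N : Set X} (hN : μ N = 0) :
    μ (f ⁻¹' N) = 0 := by
  have hm := hf.measurable (measurableSet_toMeasurable μ N)
  refine measure_mono_null (Set.preimage_mono (subset_toMeasurable μ N)) ?_
  rw [← hf.nonsingular _ hm]
  exact measure_mono_null (Set.image_preimage_subset _ _) (by rwa [measure_toMeasurable])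

theorem InMacrocosm.ae_comp {f : X → X} (hf : InMacrocosm μ f) {p : X → Prop}
    (h : ∀ᵐ x ∂μ, p x) : ∀ᵐ x ∂μ, p (f x) := by
  rw [ae_iff] at h ⊢
  exact hf.preimage_null h

namespace Graphing

theorem IsGraphing.disjUnion {F G : Graphing Ω X} (hF : F.IsGraphing μ) (hG : G.IsGraphing μ) :
    (F.disjUnion G).IsGraphing μ where
  carrier_measurable := hF.carrier_measurable.union hG.carrier_measurable
  countable := by
    have := hF.countable
    have := hG.countable
    exact inferInstanceAs (Countable (F.E ⊕ G.E))
  src_measurable := by rintro (e | e); exacts [hF.src_measurable e, hG.src_measurable e]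
  src_subset := by
    rintro (e | e)
    exacts [(hF.src_subset e).trans Set.subset_union_left,
      (hG.src_subset e).trans Set.subset_union_right]
  real_mem := by rintro (e | e); exacts [hF.real_mem e, hG.real_mem e]
  tgt_measurable := by rintro (e | e); exacts [hF.tgt_measurable e, hG.tgt_measurable e]
  tgt_subset := by
    rintro (e | e)
    exacts [(hF.tgt_subset e).trans Set.subset_union_left,
      (hG.tgt_subset e).trans Set.subset_union_right]

/-- A family of restrictions of the edges of `F` that partitions each source almost everywhere is a
refinement of `F`. -/
theorem isRefinement_of_partition {P F : Graphing Ω X} (hP : P.IsGraphing μ) (hF : F.IsGraphing μ)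
    (hinj : ∀ f, Set.InjOn (F.real f) (F.src f)) (θ : P.E → F.E)
    (hw : ∀ e, F.weight (θ e) = P.weight e) (hsub : ∀ e, P.src e ⊆ F.src (θ e))
    (hreal : ∀ e, ∀ x ∈ P.src e, P.real e x = F.real (θ e) x)
    (hdisj : ∀ e e', θ e = θ e' → e ≠ e' → Disjoint (P.src e) (P.src e'))
    (hcover : ∀ f, μ (F.src f \ ⋃ e ∈ θ ⁻¹' {f}, P.src e) = 0) : P.IsRefinement μ F := by
  have htgt : ∀ e, P.tgt e = F.real (θ e) '' P.src e := fun e =>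
    Set.image_congr fun x hx => hreal e x hx
  have hm : ∀ f, MeasurableSet (F.src f \ ⋃ e ∈ θ ⁻¹' {f}, P.src e) := fun f => by
    have := hP.countable
    exact (hF.src_measurable f).diff (.biUnion (Set.to_countable _) fun e _ => hP.src_measurable e)
  refine ⟨θ, fun e e' h hne => ⟨?_, ?_⟩, hw, fun f => ?_, fun f => ?_, fun e => ?_⟩
  · rw [(hdisj e e' h hne).inter_eq, measure_empty]
  -- Injectivity of the realiser turns disjoint sources into disjoint targets.
  · rw [htgt, htgt, ← h, ← (hinj (θ e)).image_inter (hsub e) (h ▸ hsub e'),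
      (hdisj e e' h hne).inter_eq, Set.image_empty, measure_empty]
  · rw [Set.symmDiff_def, Set.sdiff_eq_empty.2 (Set.iUnion₂_subset ?_), Set.union_empty]
    · exact hcover f
    · rintro e rfl
      exact hsub e
  · rw [Set.symmDiff_def, Set.sdiff_eq_empty.2 (Set.iUnion₂_subset ?_), Set.union_empty]
    -- The uncovered part of the target lies in the image of the uncovered part of the source, which
    -- is null by non-singularity.
    · refine measure_mono_null ?_ (((hF.real_mem f).nonsingular _ (hm f)).2 (hcover f))
      rintro _ ⟨⟨x, hx, rfl⟩, hy⟩
      refine ⟨x, ⟨hx, fun h => hy ?_⟩, rfl⟩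
      simp only [Set.mem_iUnion] at h ⊢
      obtain ⟨e, rfl, he⟩ := h
      exact ⟨e, rfl, by rw [htgt]; exact Set.mem_image_of_mem _ he⟩
    · rintro e rfl
      rw [htgt]
      exact Set.image_mono (hsub e)
  · exact .of_forall fun x hx => (hreal e x hx.2).symm

theorem measurableSet_codes {F : Graphing Ω X} (hF : F.IsGraphing μ)
    (hdiag : ∀ f g : X → X, Measurable f → Measurable g → MeasurableSet {x | f x = g x})
    (enc : F.E → ℕ) {φ : X → X} (hφ : Measurable φ) (k : ℕ) :
    MeasurableSet {x | F.codes enc x (φ x) k} := by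
  have := hF.countable
  have : {x | F.codes enc x (φ x) k} =
      ⋃ f, ⋃ _ : enc f = k, F.src f ∩ {x | F.real f x = φ x} := by
    ext x
    simp only [codes, Set.mem_ofPred_eq, Set.mem_iUnion, Set.mem_inter_iff, exists_prop]
  rw [this]
  exact .iUnion fun f => .iUnion fun _ =>
    (hF.src_measurable f).inter (hdiag _ _ (hF.real_mem f).measurable hφ)

theorem measurable_rank {F : Graphing Ω X} (hF : F.IsGraphing μ)
    (hdiag : ∀ f g : X → X, Measurable f → Measurable g → MeasurableSet {x | f x = g x})
    (enc : F.E → ℕ) {φ : X → X} (hφ : Measurable φ) (k : ℕ) :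
    Measurable fun x => F.rank enc x (φ x) k := by
  induction k with
  | zero => simp [rank]
  | succ k ih =>
    have : (fun x => F.rank enc x (φ x) (k + 1)) = (fun x => F.rank enc x (φ x) k +
        ({x | F.codes enc x (φ x) k}.indicator (fun _ => 1) x : ℕ)) := by
      ext x
      rw [rank, Nat.count_succ]
      rfl
    rw [this]
    exact ih.add (measurable_const.indicator (measurableSet_codes hF hdiag enc hφ k))

/-- Two graphings with injective edges of the same weight are equivalent if almost every point is
sent to each point by as many edges of both. -/
theorem refEquiv_of_encard {F G : Graphing Ω X} (hF : F.IsGraphing μ) (hG : G.IsGraphing μ)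
    (hFi : ∀ f, Set.InjOn (F.real f) (F.src f)) (hGi : ∀ g, Set.InjOn (G.real g) (G.src g))
    (hw : ∀ f g, F.weight f = G.weight g)
    (hdiag : ∀ f g : X → X, Measurable f → Measurable g → MeasurableSet {x | f x = g x})
    (h : ∀ᵐ x ∂μ, ∀ y, {f | x ∈ F.src f ∧ F.real f x = y}.encard =
      {g | x ∈ G.src g ∧ G.real g x = y}.encard) : RefEquiv μ F G := by
  have := hF.countable
  have := hG.countable
  obtain ⟨encF, hencF⟩ := exists_injective_nat F.E
  obtain ⟨encG, hencG⟩ := exists_injective_nat G.E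
  -- The edge (f, g) lives at the points x where f and g have the same value y and the same rank
  -- among the edges from x to y of their graphings. At each x this matches the two families of
  -- edges.
  let P : Graphing Ω X :=
    { carrier := F.carrier
      E := F.E × G.E
      weight := fun e => F.weight e.1
      src := fun e => F.src e.1 ∩ (G.src e.2 ∩ ({x | F.real e.1 x = G.real e.2 x} ∩
        {x | F.rank encF x (F.real e.1 x) (encF e.1) = G.rank encG x (F.real e.1 x) (encG e.2)}))
      real := fun e => F.real e.1 }
  have hmeas : ∀ e, MeasurableSet (P.src e) := fun e =>
    (hF.src_measurable e.1).inter ((hG.src_measurable e.2).inter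
      ((hdiag _ _ (hF.real_mem e.1).measurable (hG.real_mem e.2).measurable).inter
      (measurableSet_eq_fun (measurable_rank hF hdiag encF (hF.real_mem e.1).measurable _)
        (measurable_rank hG hdiag encG (hF.real_mem e.1).measurable _))))
  have hP : P.IsGraphing μ :=
    { carrier_measurable := hF.carrier_measurable
      countable := inferInstanceAs (Countable (F.E × G.E))
      src_measurable := hmeas
      src_subset := fun e => Set.inter_subset_left.trans (hF.src_subset e.1)
      real_mem := fun e => hF.real_mem e.1
      tgt_measurable := fun e => (hF.real_mem e.1).image_measurable _ (hmeas e)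
      tgt_subset := fun e => (Set.image_mono Set.inter_subset_left).trans (hF.tgt_subset e.1) }
  refine ⟨hF, hG, P, hP, ?_, ?_⟩
  · refine isRefinement_of_partition hP hF hFi (fun e => e.1) (fun _ => rfl)
      (fun e => Set.inter_subset_left) (fun _ _ _ => rfl) ?_ fun f => ?_
    · rintro ⟨f, g⟩ ⟨f', g'⟩ rfl hne
      rw [Set.disjoint_left]
      rintro x ⟨-, h2, h3, h4⟩ ⟨-, h2', h3', h4'⟩
      refine hne (Prod.ext rfl (hencG ?_))
      classical
      exact Nat.count_injective (p := G.codes encG x (F.real f x)) ⟨g, rfl, h2, h3.symm⟩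
        ⟨g', rfl, h2', h3'.symm⟩ (h4.symm.trans h4')
    · refine measure_mono_null ?_ (ae_iff.1 h)
      rintro x ⟨hx, hxn⟩ hall
      have h1 := hall (F.real f x)
      rw [← encard_codes F hencF, ← encard_codes G hencG] at h1
      obtain ⟨_, ⟨g, rfl, hg, hgx⟩, hc⟩ := exists_count_eq h1 ⟨f, rfl, hx, rfl⟩
      exact hxn (Set.mem_iUnion₂.2 ⟨(f, g), rfl, hx, hg, hgx.symm, hc⟩)
  · refine isRefinement_of_partition hP hG hGi (fun e => e.2) (fun e => (hw e.1 e.2).symm)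
      (fun e => fun x hx => hx.2.1) (fun e x hx => hx.2.2.1) ?_ fun g => ?_
    · rintro ⟨f, g⟩ ⟨f', g'⟩ rfl hne
      rw [Set.disjoint_left]
      rintro x ⟨h1, h2, h3, h4⟩ ⟨h1', h2', h3', h4'⟩
      refine hne (Prod.ext (hencF ?_) rfl)
      change F.real f x = G.real g x at h3
      change F.real f' x = G.real g x at h3'
      change F.rank encF x (F.real f x) (encF f) = _ at h4
      change F.rank encF x (F.real f' x) (encF f') = _ at h4'
      classical
      rw [h3] at h4
      rw [h3'] at h4'
      exact Nat.count_injective (p := F.codes encF x (G.real g x)) ⟨f, rfl, h1, h3⟩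
        ⟨f', rfl, h1', h3'⟩ (h4.trans h4'.symm)
    · refine measure_mono_null ?_ (ae_iff.1 h)
      rintro x ⟨hx, hxn⟩ hall
      have h1 := (hall (G.real g x)).symm
      rw [← encard_codes F hencF, ← encard_codes G hencG] at h1
      obtain ⟨_, ⟨f, rfl, hf, hfx⟩, hc⟩ := exists_count_eq h1 ⟨g, rfl, hx, rfl⟩
      refine hxn (Set.mem_iUnion₂.2 ⟨(f, g), rfl, hf, hx, hfx, ?_⟩)
      change F.rank _ _ _ _ = G.rank _ _ _ _
      rw [hfx]
      exact hc.symm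

/-! ### Paths -/

theorem pathReal_mem {F : Graphing Ω X} (hF : F.IsGraphing μ) (π : List F.E) :
    InMacrocosm μ (F.pathReal π) := by
  induction π with
  | nil => exact InMacrocosm.id
  | cons e π ih => exact ih.comp (hF.real_mem e)

theorem measurableSet_pathSrc {F : Graphing Ω X} (hF : F.IsGraphing μ) (π : List F.E) :
    MeasurableSet (F.pathSrc π) := by
  induction π with
  | nil => exact .univ
  | cons e π ih => exact (hF.src_measurable e).inter ((hF.real_mem e).measurable ih)

theorem pathReal_mem_carrier {F : Graphing Ω X} (hF : F.IsGraphing μ) {π : List F.E} (hπ : π ≠ [])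
    {x : X} (hx : x ∈ F.pathSrc π) : F.pathReal π x ∈ F.carrier := by
  induction π generalizing x with
  | nil => exact absurd rfl hπ
  | cons e π ih =>
    match π, ih, hx with
    | [], _, hx => exact hF.tgt_subset e ⟨x, hx.1, rfl⟩
    | e' :: π, ih, hx => exact ih (List.cons_ne_nil _ _) hx.2

/-- At almost every point, the sequences of edges that can be followed are paths. -/
theorem ae_isChain {F : Graphing Ω X} (hF : F.IsGraphing μ) (π : List F.E) :
    ∀ᵐ x ∂μ, x ∈ F.pathSrc π → π.IsChain fun e e' => μ (F.tgt e ∩ F.src e') ≠ 0 := by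
  induction π with
  | nil => exact .of_forall fun x _ => .nil
  | cons e π ih =>
    match π, ih with
    | [], _ => exact .of_forall fun x _ => .singleton _
    | e' :: π, ih =>
      -- If the first step is not allowed in a path, the points where it can be followed are sent
      -- into a null set, hence are null.
      by_cases h0 : μ (F.tgt e ∩ F.src e') = 0
      · have := (hF.real_mem e).preimage_null h0
        filter_upwards [measure_eq_zero_iff_ae_notMem.1 this] with x hx hxs
        exact absurd ⟨⟨x, hxs.1, rfl⟩, hxs.2.1⟩ hx
      · filter_upwards [(hF.real_mem e).ae_comp ih] with x hx hxs
        exact .cons_cons h0 (hx hxs.2)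

theorem isGraphing_execution [Monoid Ω] {F G : Graphing Ω X} (hF : F.IsGraphing μ)
    (hG : G.IsGraphing μ) : (execution μ F G).IsGraphing μ := by
  have hD := hF.disjUnion hG
  have := hD.countable
  have hc : MeasurableSet (cut F G) := hF.carrier_measurable.inter hG.carrier_measurable
  have hs : ∀ π : (execution μ F G).E, MeasurableSet ((execution μ F G).src π) := fun π =>
    ((measurableSet_pathSrc hD π.1).inter hc.compl).inter
      ((pathReal_mem hD π.1).measurable hc.compl)
  refine ⟨(hF.carrier_measurable.union hG.carrier_measurable).diff hc, ?_, hs, ?_,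
    fun π => pathReal_mem hD π.1, fun π => (pathReal_mem hD π.1).image_measurable _ (hs π), ?_⟩
  · have : Countable (List (F.E ⊕ G.E)) := inferInstanceAs (Countable (List (F.disjUnion G).E))
    exact inferInstanceAs (Countable {π : List (F.E ⊕ G.E) // _})
  · rintro ⟨π, hπ⟩ x ⟨⟨hx, hxc⟩, -⟩
    refine ⟨?_, hxc⟩
    match π, hπ, hx with
    | [], hπ, _ => exact absurd rfl hπ.1.1.1
    | e :: π, _, hx => exact hD.src_subset e hx.1
  · rintro ⟨π, hπ⟩ _ ⟨x, ⟨⟨hx, -⟩, hxc⟩, rfl⟩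
    exact ⟨pathReal_mem_carrier hD hπ.1.1.1 hx, hxc⟩

end Graphing

end Graphings

/-! ### Alternating paths that start and end on the left -/

section AltPaths

variable {I J : Type} [Fintype I] [Fintype J]

/-- The alternating sequences of `k + 1` elements of `I` and `k` elements of `J`. -/
def altPaths (I J : Type) [Fintype I] [Fintype J] : ℕ → Finset (List (I ⊕ J))
  | 0 => Finset.univ.map ⟨fun i => [Sum.inl i], fun i j h => by simpa using h⟩
  | k + 1 => ((Finset.univ : Finset I) ×ˢ (Finset.univ : Finset J) ×ˢ altPaths I J k).map
      ⟨fun p => Sum.inl p.1 :: Sum.inr p.2.1 :: p.2.2, fun p q h => by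
        simp only [List.cons.injEq, Sum.inl.injEq, Sum.inr.injEq] at h
        exact Prod.ext h.1 (Prod.ext h.2.1 h.2.2)⟩

theorem mem_altPaths_zero {π : List (I ⊕ J)} :
    π ∈ altPaths I J 0 ↔ ∃ i, [Sum.inl i] = π := by
  simp only [altPaths, Finset.mem_map, Finset.mem_univ, true_and]
  rfl

theorem mem_altPaths_succ {k : ℕ} {π : List (I ⊕ J)} :
    π ∈ altPaths I J (k + 1) ↔
      ∃ i j, ∃ ρ ∈ altPaths I J k, Sum.inl i :: Sum.inr j :: ρ = π := by
  simp only [altPaths, Finset.mem_map, Finset.mem_product, Finset.mem_univ, true_and,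
    Prod.exists]
  exact ⟨fun ⟨i, j, ρ, h, e⟩ => ⟨i, j, ρ, h, e⟩, fun ⟨i, j, ρ, h, e⟩ => ⟨i, j, ρ, h, e⟩⟩

theorem sum_altPaths_zero {A : Type*} [AddCommMonoid A] (φ : List (I ⊕ J) → A) :
    ∑ π ∈ altPaths I J 0, φ π = ∑ i, φ [Sum.inl i] := by
  rw [altPaths, Finset.sum_map]
  rfl

theorem sum_altPaths_succ {A : Type*} [AddCommMonoid A] (φ : List (I ⊕ J) → A) (k : ℕ) :
    ∑ π ∈ altPaths I J (k + 1), φ π =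
      ∑ i, ∑ j, ∑ π ∈ altPaths I J k, φ (Sum.inl i :: Sum.inr j :: π) := by
  rw [altPaths, Finset.sum_map, Finset.sum_product]
  refine Finset.sum_congr rfl fun i _ => ?_
  rw [Finset.sum_product]
  rfl

theorem length_of_mem_altPaths {k : ℕ} {π : List (I ⊕ J)} (h : π ∈ altPaths I J k) :
    π.length = 2 * k + 1 := by
  induction k generalizing π with
  | zero => obtain ⟨i, rfl⟩ := mem_altPaths_zero.1 h; rfl
  | succ k ih =>
    obtain ⟨i, j, ρ, hρ, rfl⟩ := mem_altPaths_succ.1 h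
    simp only [List.length_cons, ih hρ]
    ring

theorem isChain_of_mem_altPaths {k : ℕ} {π : List (I ⊕ J)} (h : π ∈ altPaths I J k) :
    (∃ i ρ, π = Sum.inl i :: ρ) ∧ π.IsChain fun e e' => e.isLeft ≠ e'.isLeft := by
  induction k generalizing π with
  | zero => obtain ⟨i, rfl⟩ := mem_altPaths_zero.1 h; exact ⟨⟨i, [], rfl⟩, .singleton _⟩
  | succ k ih =>
    obtain ⟨i, j, ρ, hρ, rfl⟩ := mem_altPaths_succ.1 h
    obtain ⟨⟨i', ρ', rfl⟩, hc⟩ := ih hρ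
    exact ⟨⟨i, _, rfl⟩, .cons_cons (by simp) (.cons_cons (by simp) hc)⟩

end AltPaths

/-! ### Wirings as graphings -/

namespace Graphing

theorem encard_disjUnion {Ω : Type w} {X : Type u} (F G : Graphing Ω X) (x y : X) :
    {e | x ∈ (F.disjUnion G).src e ∧ (F.disjUnion G).real e x = y}.encard =
      {e | x ∈ F.src e ∧ F.real e x = y}.encard + {e | x ∈ G.src e ∧ G.real e x = y}.encard := by
  rw [← (Sum.inl_injective (β := G.E)).encard_image {e | x ∈ F.src e ∧ F.real e x = y},
    ← (Sum.inr_injective (α := F.E)).encard_image {e | x ∈ G.src e ∧ G.real e x = y},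
    ← Set.encard_union_eq]
  · refine congrArg Set.encard (α := Set (F.E ⊕ G.E)) ?_
    ext (e | e)
    · exact ⟨fun h => Or.inl ⟨e, h, rfl⟩, by rintro (⟨_, h, ⟨⟩⟩ | ⟨_, h, ⟨⟩⟩); exact h⟩
    · exact ⟨fun h => Or.inr ⟨e, h, rfl⟩, by rintro (⟨_, h, ⟨⟩⟩ | ⟨_, h, ⟨⟩⟩); exact h⟩
  · rw [Set.disjoint_left]
    rintro _ ⟨e, _, rfl⟩ ⟨e', _, ⟨⟩⟩

end Graphing

/-! ### Matrix entries as numbers of paths, and commutation with execution -/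

section Commutation

variable {X : Type u} [L.Structure X] [FreeConstructors L X]

namespace UAlg

/-- The action of `U (σ U)ᵏ`. -/
def altOp (U σ : UAlg L) : ℕ → (X →₀ ℤ) →+ (X →₀ ℤ)
  | 0 => U.op
  | k + 1 => (altOp U σ k).comp (σ.op.comp U.op)

theorem altOp_apply (U σ : UAlg L) (k : ℕ) (v : X →₀ ℤ) :
    altOp U σ k v = U.op ((fun w => σ.op (U.op w))^[k] v) := by
  induction k generalizing v with
  | zero => rfl
  | succ k ih => rw [Function.iterate_succ_apply]; exact ih _

theorem op_flow_ket (a : UAlg L) (F : Flow L) (x : X) [Decidable (x ∈ openTerm X F.t)] :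
    a.op (F.ket x) = if x ∈ openTerm X F.t then ket (F.map x) a else 0 := by
  unfold Flow.ket
  split_ifs
  · exact op_single _ _
  · exact map_zero _

end UAlg

variable {Ω : Type w} [Monoid Ω]

open Classical in
theorem natCast_card_filter_eq_sum_single {ι Y : Type*} (S : Finset ι) (p : ι → Prop) (φ : ι → Y)
    (y : Y) : ((S.filter fun i => p i ∧ φ i = y).card : ℤ) =
      (∑ i ∈ S, if p i then Finsupp.single (φ i) (1 : ℤ) else 0) y := by
  rw [Finset.card_filter, Nat.cast_sum, Finsupp.finsetSum_apply]
  refine Finset.sum_congr rfl fun i _ => ?_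
  by_cases h : p i
  · rw [if_pos h, Finsupp.single_apply, Nat.cast_ite]
    exact if_congr (and_iff_right h) rfl rfl
  · rw [if_neg h, if_neg fun h' => h h'.1]
    rfl

open Classical in
theorem sum_altPaths_eq_altOp (U σ : Wiring L) (V V' : Set X) (k : ℕ) (x : X) :
    ∑ π ∈ altPaths (Fin U.length) (Fin σ.length) k,
      (if x ∈ ((U.graphing Ω V).disjUnion (σ.graphing Ω V')).pathSrc π then
        Finsupp.single (((U.graphing Ω V).disjUnion (σ.graphing Ω V')).pathReal π x) (1 : ℤ) else 0) =
      UAlg.altOp U.toAlg σ.toAlg k (Finsupp.single x 1) := by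
  induction k generalizing x with
  | zero =>
    rw [sum_altPaths_zero]
    change _ = U.toAlg.op _
    rw [UAlg.op_single, UAlg.ket_toAlg]
    refine Finset.sum_congr rfl fun i _ => ?_
    unfold Flow.ket
    refine if_congr ?_ rfl rfl
    exact ⟨fun h => h.1, fun h => ⟨h, trivial⟩⟩
  | succ k ih =>
    rw [sum_altPaths_succ]
    change _ = UAlg.altOp U.toAlg σ.toAlg k (σ.toAlg.op (U.toAlg.op _))
    rw [UAlg.op_single, UAlg.ket_toAlg, map_sum, map_sum]
    refine Finset.sum_congr rfl fun i _ => ?_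
    rw [UAlg.op_flow_ket]
    by_cases hx : x ∈ openTerm X (U.get i).t
    · rw [if_pos hx, UAlg.ket_toAlg, map_sum]
      refine Finset.sum_congr rfl fun j _ => ?_
      unfold Flow.ket
      by_cases hy : (U.get i).map x ∈ openTerm X (σ.get j).t
      · rw [if_pos hy, ← ih]
        refine Finset.sum_congr rfl fun π _ => if_congr ?_ rfl rfl
        exact ⟨fun h => h.2.2, fun h => ⟨hx, hy, h⟩⟩
      · rw [if_neg hy, map_zero]
        exact Finset.sum_eq_zero fun π _ => if_neg fun h => hy h.2.1
    · rw [if_neg hx, map_zero]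
      exact Finset.sum_eq_zero fun j _ => Finset.sum_eq_zero fun π _ => if_neg fun h => hx h.1

/-- The edges of σ have source and target inside the cut, so a sequence with both ends outside
starts and ends with an edge of U. The alternative in `hxs` is what survives the removal of the
first two edges in the induction. -/
theorem exists_mem_altPaths (U σ : Wiring L) (V : Set X) {x : X}
    {π : List ((U.graphing Ω V).E ⊕ (σ.graphing Ω (σ.supp X)).E)} (hne : π ≠ [])
    (hc : π.IsChain fun e e' => e.isLeft ≠ e'.isLeft)
    (hx : x ∈ ((U.graphing Ω V).disjUnion (σ.graphing Ω (σ.supp X))).pathSrc π)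
    (hxs : x ∉ σ.supp X ∨ ∃ i ρ, π = Sum.inl i :: ρ)
    (hys : ((U.graphing Ω V).disjUnion (σ.graphing Ω (σ.supp X))).pathReal π x ∉ σ.supp X) :
    ∃ k, π ∈ altPaths (Fin U.length) (Fin σ.length) k := by
  have hsrc : ∀ (j : Fin σ.length) (z : X), z ∈ openTerm X (σ.get j).t → z ∈ σ.supp X ∧
      (σ.get j).map z ∈ σ.supp X := fun j z hz =>
    ⟨Set.mem_iUnion₂.2 ⟨_, List.get_mem σ j, Or.inl hz⟩,
      Set.mem_iUnion₂.2 ⟨_, List.get_mem σ j, Or.inr ((σ.get j).map_mem hz)⟩⟩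
  induction h : π.length using Nat.strong_induction_on generalizing π x with
  | _ n ih =>
  match π, hne, hc, hx, hxs, hys, h with
  | Sum.inr j :: ρ, _, _, hx, hxs, _, _ =>
    rcases hxs with hxs | ⟨i, ρ', h⟩
    · exact absurd (hsrc j x hx.1).1 hxs
    · simp at h
  | [Sum.inl i], _, _, _, _, _, _ => exact ⟨0, mem_altPaths_zero.2 ⟨i, rfl⟩⟩
  | Sum.inl i :: Sum.inl j :: ρ, _, hc, _, _, _, _ =>
    exact absurd rfl (List.isChain_cons_cons.1 hc).1
  | [Sum.inl i, Sum.inr j], _, _, hx, _, hys, _ =>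
    exact absurd (hsrc j _ hx.2.1).2 hys
  | Sum.inl i :: Sum.inr j :: Sum.inr j' :: ρ, _, hc, _, _, _, _ =>
    exact absurd rfl (List.isChain_cons_cons.1 (List.isChain_cons_cons.1 hc).2).1
  | Sum.inl i :: Sum.inr j :: Sum.inl i' :: ρ, _, hc, hx, _, hys, h =>
    obtain ⟨k, hk⟩ := ih (Sum.inl i' :: ρ).length (by rw [← h]; simp) (List.cons_ne_nil _ _)
      (List.isChain_cons_cons.1 (List.isChain_cons_cons.1 hc).2).2 hx.2.2 (Or.inr ⟨i', ρ, rfl⟩)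
      hys rfl
    exact ⟨k + 1, mem_altPaths_succ.2 ⟨i, j, _, hk, rfl⟩⟩

theorem encard_graphing (W : Wiring L) (V : Set X) (x y : X) :
    ∃ c : ℕ, {f | x ∈ (W.graphing Ω V).src f ∧ (W.graphing Ω V).real f x = y}.encard = c ∧
      (c : ℤ) = UAlg.ket x W.toAlg y := by
  classical
  refine ⟨(Finset.univ.filter fun i : Fin W.length =>
    x ∈ openTerm X (W.get i).t ∧ (W.get i).map x = y).card, ?_, ?_⟩
  · rw [← Set.encard_coe_eq_coe_finsetCard, Finset.coe_filter]
    congr 1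
    ext i
    exact ⟨fun h => ⟨Finset.mem_univ (α := Fin W.length) i, h⟩, fun h => h.2⟩
  · rw [UAlg.ket_toAlg]
    exact natCast_card_filter_eq_sum_single _ _ _ _

variable [MeasurableSpace X] {μ : Measure X} {good : X → Prop}

theorem isGraphing_graphing (hopen : ∀ t : L.Term ℕ, MeasurableSet (openTerm X t))
    (hmap : ∀ F : Flow L, InMacrocosm μ F.map) (W : Wiring L) {V : Set X} (hV : MeasurableSet V)
    (hW : W.supp X ⊆ V) : (W.graphing Ω V).IsGraphing μ := by
  have htgt : ∀ i, (W.graphing Ω V).tgt i = openTerm X (W.get i).u := fun i =>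
    (W.get i).image_map
  exact
  { carrier_measurable := hV
    countable := inferInstanceAs (Countable (Fin W.length))
    src_measurable := fun i => hopen _
    src_subset := fun i => subset_trans
      (fun x hx => Set.mem_iUnion₂.2 ⟨_, List.get_mem W i, Or.inl hx⟩) hW
    real_mem := fun i => hmap _
    tgt_measurable := fun i => by rw [htgt]; exact hopen _
    tgt_subset := fun i => by
      rw [htgt]
      exact subset_trans (fun x hx => Set.mem_iUnion₂.2 ⟨_, List.get_mem W i, Or.inr hx⟩) hW }

-- Expanding U(σU)ᵏ as a sum over alternating sequences, each sequence defined at x contributes its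
-- endpoint. The two factors 1 - σ² keep those that are outer at both ends.
open Graphing in
theorem ae_encard_execution (hg : IsUnifying L good) (hae : ∀ᵐ x ∂μ, good x)
    {U σ : Wiring L} {V : Set X} (hU : (U.graphing Ω V).IsGraphing μ)
    (hσ : (σ.graphing Ω (σ.supp X)).IsGraphing μ)
    (hadj : σ.toAlg.adj = σ.toAlg) (hproj : σ.toAlg ^ 2 * σ.toAlg ^ 2 = σ.toAlg ^ 2) {n : ℕ}
    (hn : (U.toAlg * σ.toAlg) ^ n = 0) (hV : σ.supp X ⊆ V) :
    ∀ᵐ x ∂μ, ∀ y, ∃ c : ℕ,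
      {π | x ∈ (execution μ (U.graphing Ω V) (σ.graphing Ω (σ.supp X))).src π ∧
        (execution μ (U.graphing Ω V) (σ.graphing Ω (σ.supp X))).real π x = y}.encard = c ∧
      (c : ℤ) = UAlg.ket x (UAlg.ex U.toAlg σ.toAlg) y := by
  classical
  have hD := hU.disjUnion hσ
  set F := U.graphing Ω V with hF
  set G := σ.graphing Ω (σ.supp X) with hG
  have hcount : Countable (List (F.E ⊕ G.E)) := by
    have := hD.countable
    exact inferInstanceAs (Countable (List (F.disjUnion G).E))
  have hcut : cut F G = σ.supp X := Set.inter_eq_right.2 hV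
  -- There are countably many sequences. Outside one null set, following a sequence makes it a path,
  -- and the sequences dropped because their outer source is null are not followed.
  have h1 := ae_all_iff.2 fun π : List (F.E ⊕ G.E) => ae_isChain hD π
  have h2 : ∀ᵐ x ∂μ, ∀ π : List (F.E ⊕ G.E), μ (outerSrc F G π) = 0 → x ∉ outerSrc F G π :=
    ae_all_iff.2 fun π => by
      by_cases h : μ (outerSrc F G π) = 0
      · filter_upwards [measure_eq_zero_iff_ae_notMem.1 h] with x hx _ using hx
      · exact .of_forall fun x h' => absurd h' h
  filter_upwards [hae, h1, h2] with x hx h1 h2 y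
  rw [UAlg.ket_ex hg (UAlg.toAlg_mem_cone U) hadj hproj hn hx]
  by_cases hxs : x ∈ σ.supp X
  · refine ⟨0, ?_, by simp [hxs]⟩
    rw [Nat.cast_zero, Set.encard_eq_zero, Set.eq_empty_iff_forall_notMem]
    rintro π ⟨⟨⟨-, h⟩, -⟩, -⟩
    exact h (hcut ▸ hxs)
  rw [if_neg hxs, Finsupp.filter_apply]
  by_cases hys : y ∈ σ.supp X
  · refine ⟨0, ?_, by simp [hys]⟩
    rw [Nat.cast_zero, Set.encard_eq_zero, Set.eq_empty_iff_forall_notMem]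
    rintro π ⟨⟨-, h⟩, rfl⟩
    exact h (hcut ▸ hys)
  rw [if_pos hys]
  have hket : ∀ k, UAlg.ket x (U.toAlg * (σ.toAlg * U.toAlg) ^ k) =
      ∑ π ∈ altPaths (Fin U.length) (Fin σ.length) k,
        if x ∈ (F.disjUnion G).pathSrc π then
          Finsupp.single ((F.disjUnion G).pathReal π x) (1 : ℤ) else 0 := by
    intro k
    rw [← UAlg.op_single, UAlg.op_alternating hg _ _ _ (UAlg.single_mem_goodSpan hx),
      ← UAlg.altOp_apply]
    exact (sum_altPaths_eq_altOp (Ω := Ω) U σ V (σ.supp X) k x).symm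
  -- A sequence with k ≥ n defined at x would give a positive entry to U(σU)ᵏ = 0. Hence only
  -- finitely many paths can be followed from x.
  have hbound : ∀ k, ∀ π ∈ altPaths (Fin U.length) (Fin σ.length) k,
      x ∈ (F.disjUnion G).pathSrc π → k < n := by
    intro k π hπ hxπ
    by_contra hk
    have h0 := hket k
    rw [UAlg.alternating_eq_zero hg (UAlg.toAlg_mem_cone U) (UAlg.toAlg_mem_cone σ) hn
      (not_lt.1 hk), map_zero] at h0
    have h0 := DFunLike.congr_fun h0.symm ((F.disjUnion G).pathReal π x)
    rw [Finsupp.finsetSum_apply, Finsupp.zero_apply, Finset.sum_eq_zero_iff_of_nonneg] at h0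
    · have := h0 π hπ
      rw [if_pos hxπ, Finsupp.single_eq_same] at this
      exact one_ne_zero this
    · intro π _
      split_ifs
      · rw [Finsupp.single_apply]; split_ifs <;> simp
      · simp
  set P : ℕ → Finset (List (F.E ⊕ G.E)) := fun k =>
    (altPaths (Fin U.length) (Fin σ.length) k).filter fun π =>
      x ∈ (F.disjUnion G).pathSrc π ∧ (F.disjUnion G).pathReal π x = y with hP
  refine ⟨((Finset.range n).biUnion P).card, ?_, ?_⟩
  · rw [← Set.encard_coe_eq_coe_finsetCard]
    refine (Subtype.val_injective.encard_image _).symm.trans (congrArg Set.encard ?_)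
    ext π
    constructor
    · rintro ⟨⟨π, hπ⟩, ⟨⟨⟨hxπ, -⟩, -⟩, hy⟩, rfl⟩
      obtain ⟨k, hk⟩ := exists_mem_altPaths U σ V hπ.1.1.1 hπ.1.2 hxπ (Or.inl hxs)
        fun h => hys (hy ▸ h)
      exact Finset.mem_biUnion.2 ⟨k, Finset.mem_range.2 (hbound k π hk hxπ),
        Finset.mem_filter.2 ⟨hk, hxπ, hy⟩⟩
    · intro hπ
      obtain ⟨k, -, hk⟩ := Finset.mem_biUnion.1 hπ
      obtain ⟨hk, hxπ, hy⟩ := Finset.mem_filter.1 hk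
      obtain ⟨⟨i, ρ, hi⟩, hc⟩ := isChain_of_mem_altPaths hk
      have hout : x ∈ outerSrc F G π := by
        refine ⟨⟨hxπ, ?_⟩, ?_⟩
        · rw [hcut]; exact hxs
        · rw [hcut, Set.mem_preimage, hy]; exact hys
      exact ⟨⟨π, ⟨⟨hi ▸ List.cons_ne_nil _ _, h1 π hxπ⟩, hc⟩, fun h => h2 π h hout⟩,
        ⟨hout, hy⟩, rfl⟩
  · rw [Finset.card_biUnion, Nat.cast_sum, Finsupp.finsetSum_apply]
    · refine Finset.sum_congr rfl fun k _ => ?_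
      rw [hket]
      exact natCast_card_filter_eq_sum_single _ _ _ _
    · intro k _ k' _ hne
      refine Finset.disjoint_left.2 fun π h h' => hne ?_
      have e1 := length_of_mem_altPaths (Finset.mem_filter.1 h).1
      have e2 := length_of_mem_altPaths (Finset.mem_filter.1 h').1
      omega

open Graphing in
/-- Commutation with execution, for a measure space on which unification computes the composition of
flows almost everywhere. -/
theorem commutesWithExecution_of_isUnifying (hg : IsUnifying L good) (hae : ∀ᵐ x ∂μ, good x)
    (hopen : ∀ t : L.Term ℕ, MeasurableSet (openTerm X t))
    (hmap : ∀ F : Flow L, InMacrocosm μ F.map)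
    (hdiag : ∀ f g : X → X, Measurable f → Measurable g → MeasurableSet {x | f x = g x}) :
    CommutesWithExecution L Ω μ := by
  refine ⟨fun W V hV hW => isGraphing_graphing hopen hmap W hV hW,
    fun U σ hadj hproj ⟨n, hn⟩ V hV hUV hσV => ?_⟩
  have hsm : MeasurableSet (σ.supp X) :=
    .biUnion (List.finite_toSet σ).countable fun F _ => (hopen _).union (hopen _)
  have hU := isGraphing_graphing (Ω := Ω) hopen hmap U hV hUV
  have hσ := isGraphing_graphing (Ω := Ω) hopen hmap σ hsm subset_rfl
  have hE := isGraphing_execution hU hσ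
  have hW : ∀ W : Wiring L, (W.graphing Ω Set.univ).IsGraphing μ := fun W =>
    isGraphing_graphing hopen hmap W .univ (Set.subset_univ _)
  have hWi : ∀ (W : Wiring L) (V : Set X) (i), Set.InjOn ((W.graphing Ω V).real i)
      ((W.graphing Ω V).src i) := fun W V i => (W.get i).map_injOn
  have hEi : ∀ π, Set.InjOn ((execution μ (U.graphing Ω V) (σ.graphing Ω (σ.supp X))).real π)
      ((execution μ (U.graphing Ω V) (σ.graphing Ω (σ.supp X))).src π) := fun π =>
    (pathReal_injOn (F := (U.graphing Ω V).disjUnion (σ.graphing Ω (σ.supp X)))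
      (by rintro (e | e); exacts [hWi U _ e, hWi σ _ e]) π.1).mono
      (Set.inter_subset_left.trans Set.inter_subset_left)
  have hEw : ∀ π, (execution μ (U.graphing Ω V) (σ.graphing Ω (σ.supp X))).weight π = 1 := by
    intro π
    refine List.prod_eq_one fun a ha => ?_
    obtain ⟨e | e, -, rfl⟩ := List.mem_map.1 ha <;> rfl
  have hcount := ae_encard_execution hg hae hU hσ hadj hproj hn hσV
  refine ⟨fun W hWe => ?_, fun W W' hWe => ?_⟩
  · refine refEquiv_of_encard (hW W) hE (hWi W _) hEi (fun f π => (hEw π).symm) hdiag ?_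
    filter_upwards [hcount] with x hx y
    obtain ⟨c, hc, hce⟩ := hx y
    obtain ⟨d, hd, hde⟩ := encard_graphing (Ω := Ω) W Set.univ x y
    rw [hc, hd, Nat.cast_inj, ← Nat.cast_inj (R := ℤ), hce, hde, hWe]
  · refine refEquiv_of_encard (hW W) (hE.disjUnion (hW W')) (hWi W _)
      (by rintro (π | i); exacts [hEi π, hWi W' _ i])
      (by rintro f (π | i); exacts [(hEw π).symm, rfl]) hdiag ?_
    filter_upwards [hcount] with x hx y
    obtain ⟨c, hc, hce⟩ := hx y
    obtain ⟨d, hd, hde⟩ := encard_graphing (Ω := Ω) W Set.univ x y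
    obtain ⟨d', hd', hde'⟩ := encard_graphing (Ω := Ω) W' Set.univ x y
    rw [encard_disjUnion, hc, hd, hd', ← Nat.cast_add, Nat.cast_inj, ← Nat.cast_inj (R := ℤ),
      Nat.cast_add, hce, hde, hde', ← hWe, map_sub, Finsupp.sub_apply, sub_add_cancel]

end Commutation

/-! ### Finite closed terms -/

section ClosedTerms

variable [L.IsAlgebraic]

instance : FreeConstructors L (ClosedTerm L) where
  inj := by
    intro n m f g a b h
    obtain ⟨rfl, hf, ha⟩ := Term.func.inj (h : (Term.func f a : L.Term Empty) = Term.func g b)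
    rw [eq_of_heq hf, eq_of_heq ha]

/-- A closed term as a term. -/
def ClosedTerm.toTerm (x : ClosedTerm L) : L.Term ℕ := Term.relabel (L := L) Empty.elim x

theorem ClosedTerm.toTerm_realize {α : Type*} (t : L.Term α) (S : α → ClosedTerm L) :
    (t.realize S).toTerm = t.subst fun a => (S a).toTerm := by
  induction t with
  | var a => rfl
  | func f ts ih =>
    simp only [Term.subst, ← ih]
    rfl

theorem ClosedTerm.realize_toTerm (x : ClosedTerm L) (S : ℕ → ClosedTerm L) :
    x.toTerm.realize S = x := by
  have : ∀ t : L.Term Empty, (t.relabel Empty.elim : L.Term ℕ).realize S = (t : ClosedTerm L) := by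
    intro t
    induction t with
    | var a => exact a.elim
    | func f ts ih =>
      simp only [Term.relabel, Term.realize_func, ih]
      rfl
  exact this x

/-- A finite closed term is itself a term without variables, and serves as the common instance. A
constant ensures that every term has closed instances. -/
theorem ClosedTerm.isUnifying [Nonempty (L.Functions 0)] :
    IsUnifying L (X := ClosedTerm L) fun _ => True where
  common_instance := by
    rintro x - t t' ⟨S, rfl⟩ ⟨S', h⟩
    refine ⟨(t.realize S).toTerm, fun a => (S a).toTerm, fun a => (S' a).toTerm,
      ClosedTerm.toTerm_realize t S, ?_, S, ClosedTerm.realize_toTerm _ S⟩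
    rw [← ClosedTerm.toTerm_realize]
    exact congrArg _ h.symm
  map := fun _ _ _ _ => trivial
  exists_mem := fun t => by
    obtain ⟨c⟩ := ‹Nonempty (L.Functions 0)›
    exact ⟨_, ⟨fun _ => (Term.func c Fin.elim0 : L.Term Empty), rfl⟩, trivial⟩

theorem ClosedTerm.commutesWithExecution [Nonempty (L.Functions 0)] (Ω : Type w) [Monoid Ω] :
    CommutesWithExecution L Ω (Measure.count : Measure (ClosedTerm L)) := by
  have : DiscreteMeasurableSpace (ClosedTerm L) := ⟨fun _ => trivial⟩
  refine commutesWithExecution_of_isUnifying ClosedTerm.isUnifying (.of_forall fun _ => trivial)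
    (fun _ => .of_discrete) (fun F => ⟨.of_discrete, fun _ _ => .of_discrete, fun A _ => ?_⟩)
    fun _ _ _ _ => .of_discrete
  -- Only the empty set is null for the counting measure.
  rw [Measure.count_eq_zero_iff, Measure.count_eq_zero_iff, Set.image_eq_empty]

end ClosedTerms

/-! ### Infinite trees -/

section Trees

/-- The functor of the labelled nodes. -/
abbrev nodeFunctor (L : FirstOrder.Language.{u, v}) : PFunctor.{u, 0} := ⟨Sym L, fun f => Fin f.1⟩

/-- The arity of a symbol. -/
def Sym.arity (f : Sym L) : ℕ := f.1

/-- The term with a given head symbol. -/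
def Sym.app {α : Type*} (f : Sym L) (ts : Fin f.arity → L.Term α) : L.Term α := Term.func f.2 ts

namespace Tree

/-- The tree with given root and immediate subtrees. -/
def node (f : Sym L) (ts : Fin f.arity → Tree L) : Tree L :=
  PFunctor.M.mk (F := nodeFunctor L) ⟨f, ts⟩

theorem exists_eq_node (x : Tree L) : ∃ f ts, x = node f ts :=
  ⟨_, _, (PFunctor.M.mk_dest (F := nodeFunctor L) x).symm⟩

/-- The label of the root. -/
def root (x : Tree L) : Sym L := (PFunctor.M.dest (F := nodeFunctor L) x).1

/-- The immediate subtree in the direction `i`, or the tree itself if there is none. -/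
def child (i : ℕ) (x : Tree L) : Tree L :=
  if h : i < x.root.arity then (PFunctor.M.dest (F := nodeFunctor L) x).2 ⟨i, h⟩ else x

@[simp] theorem root_node (f : Sym L) (ts : Fin f.arity → Tree L) : root (node f ts) = f := rfl

theorem child_node (f : Sym L) (ts : Fin f.arity → Tree L) {i : ℕ} (hi : i < f.arity) :
    child i (node f ts) = ts ⟨i, hi⟩ :=
  dif_pos (show i < (root (node f ts)).arity from hi)

theorem child_of_not_lt {i : ℕ} {x : Tree L} (h : ¬ i < x.root.arity) : child i x = x := dif_neg h

theorem node_root_child (x : Tree L) : node x.root (fun i => child i x) = x := by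
  obtain ⟨f, ts, rfl⟩ := exists_eq_node x
  exact congrArg (node f) (funext fun i => child_node f ts i.2)

/-- The subtree that is reached by a list of directions. -/
def sub : List ℕ → Tree L → Tree L
  | [], x => x
  | i :: p, x => sub p (child i x)

theorem sub_append (p q : List ℕ) (x : Tree L) : sub (p ++ q) x = sub q (sub p x) := by
  induction p generalizing x with
  | nil => rfl
  | cons i p ih => exact ih _

/-- Having the same labels at all positions is a bisimulation. -/
theorem eq_of_root_sub {x y : Tree L} (h : ∀ p, (sub p x).root = (sub p y).root) : x = y := by
  refine PFunctor.M.bisim (P := nodeFunctor L)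
    (fun x y : Tree L => ∀ p, (sub p x).root = (sub p y).root) (fun x y hxy => ?_) x y h
  obtain ⟨f, ts, rfl⟩ := exists_eq_node (L := L) x
  obtain ⟨g, us, rfl⟩ := exists_eq_node (L := L) y
  obtain rfl : f = g := hxy []
  refine ⟨f, ts, us, rfl, rfl, fun (i : Fin f.arity) p => ?_⟩
  have := hxy (i :: p)
  rwa [sub.eq_2, sub.eq_2, child_node f ts i.2, child_node f us i.2] at this

section

variable [L.IsAlgebraic]

theorem child_funMap {n : ℕ} (f : L.Functions n) (ts : Fin n → Tree L) {i : ℕ} (hi : i < n) :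
    child i (Structure.funMap f ts) = ts ⟨i, hi⟩ :=
  child_node ⟨n, f⟩ ts hi

theorem child_funMap_of_not_lt {n : ℕ} (f : L.Functions n) (ts : Fin n → Tree L) {i : ℕ}
    (hi : ¬ i < n) : child i (Structure.funMap f ts) = Structure.funMap f ts :=
  child_of_not_lt (show ¬ i < (root (Structure.funMap f ts)).arity from hi)

theorem realize_app {α : Type*} (f : Sym L) (ts : Fin f.arity → L.Term α) (S : α → Tree L) :
    (f.app ts).realize S = node f fun i => (ts i).realize S := rfl

instance : FreeConstructors L (Tree L) where
  inj := by
    intro n m f g a b h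
    have h' := PFunctor.M.mk_inj (F := nodeFunctor L) h
    obtain ⟨h1, h2⟩ := Sigma.mk.inj h'
    obtain ⟨rfl, h3⟩ := Sigma.mk.inj h1
    obtain rfl := eq_of_heq h3
    rw [eq_of_heq h2]

end

/-- Growing from the state p is growing from the root with shifted labels: the states q ++ p and q
are bisimilar. Positions list the last direction first, so the shift is appended at the end. -/
theorem corec_eq_growTree (ω : List ℕ → Sym L) (p : List ℕ) :
    (PFunctor.M.corec (F := nodeFunctor L) (fun p : List ℕ => ⟨ω p, fun i => (i : ℕ) :: p⟩) p :
      Tree L) = growTree fun q => ω (q ++ p) := by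
  refine PFunctor.M.bisim (P := nodeFunctor L) (fun x y => ∃ q : List ℕ,
    x = PFunctor.M.corec (F := nodeFunctor L) (fun p : List ℕ => ⟨ω p, fun i => (i : ℕ) :: p⟩)
      (q ++ p) ∧
    y = PFunctor.M.corec (F := nodeFunctor L)
      (fun r : List ℕ => ⟨ω (r ++ p), fun i => (i : ℕ) :: r⟩) q) ?_ _ _ ⟨[], rfl, rfl⟩
  rintro _ _ ⟨q, rfl, rfl⟩
  refine ⟨ω (q ++ p), _, _, PFunctor.M.dest_corec _ _, PFunctor.M.dest_corec _ _, fun i => ?_⟩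
  exact ⟨(i : Fin _) :: q, rfl, rfl⟩

theorem growTree_eq_node (ω : List ℕ → Sym L) :
    growTree ω = node (ω []) fun i => growTree fun q => ω (q ++ [(i : ℕ)]) :=
  (PFunctor.M.corec_def _ _).trans
    (congrArg (node (ω [])) (funext fun i => corec_eq_growTree ω [(i : ℕ)]))

theorem root_growTree (ω : List ℕ → Sym L) : root (growTree ω) = ω [] := by
  rw [growTree_eq_node, root_node]

theorem child_growTree (ω : List ℕ → Sym L) (i : ℕ) : child i (growTree ω) =
    if i < (ω []).arity then growTree fun q => ω (q ++ [i]) else growTree ω := by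
  split_ifs with h
  · rw [growTree_eq_node ω, child_node _ _ h]
  · exact child_of_not_lt (by rwa [root_growTree])

end Tree

end Trees

/-! ### Measurability on trees -/

section TreeMeasurable

namespace Tree

instance : DiscreteMeasurableSpace (Sym L) := ⟨fun _ => trivial⟩

/-- All the labels of a family of trees are measurable. -/
def LabelMeasurable {Y : Type*} [MeasurableSpace Y] (h : Y → Tree L) : Prop :=
  ∀ p, Measurable fun y => (sub p (h y)).root

theorem LabelMeasurable.measurableSet_eq [Countable (Sym L)] {Y : Type*} [MeasurableSpace Y] {h h' : Y → Tree L}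
    (hh : LabelMeasurable h) (hh' : LabelMeasurable h') : MeasurableSet {y | h y = h' y} := by
  have : {y | h y = h' y} = ⋂ p, {y | (sub p (h y)).root = (sub p (h' y)).root} := by
    ext y
    simp only [Set.mem_ofPred_eq, Set.mem_iInter]
    exact ⟨fun h p => by rw [h], eq_of_root_sub⟩
  rw [this]
  exact .iInter fun p => measurableSet_eq_fun (hh p) (hh' p)

theorem LabelMeasurable.subtree {Y : Type*} [MeasurableSpace Y] {h : Y → Tree L}
    (hh : LabelMeasurable h) (q : List ℕ) : LabelMeasurable fun y => sub q (h y) := fun p => by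
  simp only [← sub_append]
  exact hh _

theorem labelMeasurable_growTree {ι : Type*} (n : ι) (q : List ℕ) :
    LabelMeasurable fun ω : ι × List ℕ → Sym L => growTree fun r => ω (n, r ++ q) := by
  intro p
  induction p generalizing q with
  | nil =>
    simp only [Tree.sub, root_growTree]
    exact measurable_pi_apply _
  | cons i p ih =>
    simp only [Tree.sub, child_growTree, apply_ite (Tree.sub p), apply_ite root, List.append_assoc]
    refine Measurable.ite ?_ (ih ([i] ++ q)) (ih q)
    have h : Measurable fun ω : ι × List ℕ → Sym L => ω (n, [] ++ q) := measurable_pi_apply _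
    exact h (.of_discrete : MeasurableSet {f : Sym L | i < f.arity})

variable [L.IsAlgebraic]

/-- Each variable of a term occurs at some position of its instances. -/
theorem exists_sub_realize (t : L.Term ℕ) (n : ℕ) :
    ∃ p : List ℕ, n ∈ termVars t → ∀ S : ℕ → Tree L, sub p (t.realize S) = S n := by
  by_cases hn : n ∈ termVars t
  · induction t with
    | var a => exact ⟨[], fun h S => by rw [mem_termVars_var.1 h]; rfl⟩
    | func f ts ih =>
      obtain ⟨i, hi⟩ := mem_termVars_func.1 hn
      obtain ⟨p, hp⟩ := ih i hi
      refine ⟨i :: p, fun _ S => ?_⟩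
      rw [sub, Term.realize_func, child_funMap f _ i.2]
      exact hp hi S
  · exact ⟨[], fun h => absurd h hn⟩

/-- The assignments for the variables of `t` that are read off from an instance of `t`. -/
def extract (t : L.Term ℕ) (n : ℕ) (x : Tree L) : Tree L := sub (exists_sub_realize t n).choose x

theorem extract_realize {t : L.Term ℕ} {n : ℕ} (hn : n ∈ termVars t) (S : ℕ → Tree L) :
    extract t n (t.realize S) = S n :=
  (exists_sub_realize t n).choose_spec hn S

theorem mem_openTerm_iff (t : L.Term ℕ) (x : Tree L) :
    x ∈ openTerm (Tree L) t ↔ t.realize (fun n => extract t n x) = x := by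
  refine ⟨?_, fun h => ⟨_, h⟩⟩
  rintro ⟨S, rfl⟩
  exact realize_congr t fun n hn => extract_realize hn S

theorem measurableSet_openTerm (t : L.Term ℕ) : MeasurableSet (openTerm (Tree L) t) :=
  MeasurableSpace.measurableSet_generateFrom (TopologicalSpace.isOpen_generateFrom_of_mem ⟨t, rfl⟩)

theorem LabelMeasurable.realize {Y : Type*} [MeasurableSpace Y] {α : Type*} (t : L.Term α)
    {S : Y → α → Tree L} (hS : ∀ a, LabelMeasurable fun y => S y a) :
    LabelMeasurable fun y => t.realize (S y) := by
  induction t with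
  | var a => exact hS a
  | func f ts ih =>
    rename_i n
    intro p
    induction p with
    | nil => exact measurable_const
    | cons i p ihp =>
      by_cases hi : i < n
      · simp only [Tree.sub, Term.realize_func, child_funMap f _ hi]
        exact ih ⟨i, hi⟩ p
      · simp only [Tree.sub, Term.realize_func, child_funMap_of_not_lt f _ hi]
        exact ihp

/-- This expresses images through preimages under the adjoint flow, so that images of measurable
sets are measurable. -/
theorem image_flowMap (F : Flow L) (A : Set (Tree L)) :
    F.map '' A = (openTerm (Tree L) F.u ∩ F.adj.map ⁻¹' (A ∩ openTerm (Tree L) F.t)) ∪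
      (A \ openTerm (Tree L) F.t) := by
  ext y
  constructor
  · rintro ⟨x, hx, rfl⟩
    by_cases h : x ∈ openTerm (Tree L) F.t
    · exact Or.inl ⟨F.map_mem h, by rw [Set.mem_preimage, F.adj_map_map h]; exact ⟨hx, h⟩⟩
    · exact Or.inr (by rw [F.map_of_notMem h]; exact ⟨hx, h⟩)
  · rintro (⟨h1, h2⟩ | ⟨h1, h2⟩)
    · exact ⟨_, h2.1, F.adj.adj_map_map h1⟩
    · exact ⟨y, h1, F.map_of_notMem h2⟩

variable [Countable (Sym L)]

/-- There are countably many terms, so the Borel sets are generated by the sets 𝒪(t) as a σ-algebra.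
-/
theorem measurable_of_openTerm {Y : Type*} [MeasurableSpace Y] {h : Y → Tree L}
    (hh : ∀ t : L.Term ℕ, MeasurableSet (h ⁻¹' openTerm (Tree L) t)) : Measurable h := by
  have : Countable (Σ n, L.Functions n) := inferInstanceAs (Countable (Sym L))
  have : SecondCountableTopology (Tree L) :=
    ⟨⟨_, Set.countable_range (openTerm (L := L) (Tree L)), rfl⟩⟩
  have hb : borel (Tree L) = .generateFrom (Set.range (openTerm (L := L) (Tree L))) :=
    borel_eq_generateFrom_of_subbasis rfl
  have key : Measurable[_, .generateFrom (Set.range (openTerm (L := L) (Tree L)))] h := by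
    refine measurable_generateFrom ?_
    rintro _ ⟨t, rfl⟩
    exact hh t
  rw [← hb] at key
  exact key

theorem measurable_root : Measurable (root : Tree L → Sym L) := by
  refine measurable_to_countable' fun f => ?_
  convert measurableSet_openTerm (f.app fun i => Term.var (i : ℕ)) using 1
  ext x
  constructor
  · rintro rfl
    exact ⟨fun i => child i x, node_root_child x⟩
  · rintro ⟨S, rfl⟩
    rfl

theorem measurable_child (i : ℕ) : Measurable (child i : Tree L → Tree L) := by
  refine measurable_of_openTerm fun u => ?_
  -- The i-th child is an instance of u iff the tree is an instance of some f(…, u, …) with fresh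
  -- variables elsewhere: even variables are kept for u, odd ones for the other arguments. If there
  -- is no i-th child, `child i` is the identity.
  have : child i ⁻¹' openTerm (Tree L) u =
      (⋃ f ∈ {f : Sym L | i < f.arity}, openTerm (Tree L) (f.app fun j : Fin f.arity =>
        if (j : ℕ) = i then u.relabel (2 * ·) else Term.var (2 * (j : ℕ) + 1))) ∪
      (root ⁻¹' {f | ¬ i < f.arity} ∩ openTerm (Tree L) u) := by
    ext x
    rw [Set.mem_union, Set.mem_preimage, Set.mem_iUnion₂]
    constructor
    · rintro ⟨S, hS⟩
      obtain ⟨f, ts, rfl⟩ := exists_eq_node x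
      by_cases hi : i < f.arity
      · refine Or.inl ⟨f, hi, fun n => if n % 2 = 0 then S (n / 2) else child (n / 2) (node f ts), ?_⟩
        refine (realize_app _ _ _).trans (congrArg (node f) (funext fun j => ?_))
        split_ifs with hj
        · rw [child_node f ts hi] at hS
          rw [Term.realize_relabel, show j = ⟨i, hi⟩ from Fin.ext hj, ← hS]
          exact realize_congr u fun n _ => by simp
        · rw [Term.realize_var, if_neg (by omega), show (2 * (j : ℕ) + 1) / 2 = j by omega,
            child_node f ts j.2]
      · refine Or.inr ⟨hi, S, ?_⟩
        rwa [child_of_not_lt hi] at hS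
    · rintro (⟨f, hf, S, rfl⟩ | ⟨hi, h⟩)
      · dsimp only
        rw [realize_app, child_node f _ hf]
        simp only [if_true, Term.realize_relabel]
        exact ⟨_, rfl⟩
      · rwa [child_of_not_lt hi]
  rw [this]
  exact .union (.biUnion (Set.to_countable _) fun f _ => measurableSet_openTerm _)
    (.inter (measurable_root .of_discrete) (measurableSet_openTerm _))

theorem measurable_sub (p : List ℕ) : Measurable (sub p : Tree L → Tree L) := by
  induction p with
  | nil => exact measurable_id
  | cons i p ih => exact ih.comp (measurable_child i)

theorem _root_.Measurable.labelMeasurable {Y : Type*} [MeasurableSpace Y] {h : Y → Tree L}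
    (hh : Measurable h) : LabelMeasurable h := fun p =>
  measurable_root.comp ((measurable_sub p).comp hh)

/-- Membership in 𝒪(t) says that rebuilding t from the extracted subtrees gives the tree back. This
is an equality of two label-measurable maps. -/
theorem LabelMeasurable.measurable {Y : Type*} [MeasurableSpace Y] {h : Y → Tree L}
    (hh : LabelMeasurable h) : Measurable h := by
  refine measurable_of_openTerm fun t => ?_
  have : h ⁻¹' openTerm (Tree L) t = {y | t.realize (fun n => extract t n (h y)) = h y} := by
    ext y
    exact mem_openTerm_iff t (h y)
  rw [this]
  exact (LabelMeasurable.realize t fun n => hh.subtree _).measurableSet_eq hh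

theorem measurableSet_eq (f g : Tree L → Tree L) (hf : Measurable f) (hg : Measurable g) :
    MeasurableSet {x | f x = g x} :=
  hf.labelMeasurable.measurableSet_eq hg.labelMeasurable

theorem measurable_flowMap (F : Flow L) : Measurable (F.map : Tree L → Tree L) := by
  classical
  have : (F.map : Tree L → Tree L) = fun x => if x ∈ openTerm (Tree L) F.t then
      F.u.realize (fun n => extract F.t n x) else x := by
    funext x
    split_ifs with h
    · conv_lhs => rw [← (mem_openTerm_iff _ _).1 h, F.map_realize]
    · exact F.map_of_notMem h
  rw [this]
  exact Measurable.ite (measurableSet_openTerm _)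
    (LabelMeasurable.realize _ fun n => (measurable_sub _).labelMeasurable).measurable measurable_id

theorem measurableSet_image_flowMap (F : Flow L) {A : Set (Tree L)} (hA : MeasurableSet A) :
    MeasurableSet (F.map '' A) := by
  rw [image_flowMap]
  exact ((measurableSet_openTerm _).inter (measurable_flowMap F.adj
    (hA.inter (measurableSet_openTerm _)))).union (hA.diff (measurableSet_openTerm _))

end Tree

end TreeMeasurable

/-! ### Generic trees -/

section GenericTrees

namespace Tree

/-- A list of directions that can be followed in a tree. -/
def Valid : List ℕ → Tree L → Prop
  | [], _ => True
  | i :: p, x => i < x.root.arity ∧ Valid p (child i x)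

/-- All the subtrees of the trees of a set at different positions are different. -/
def Generic (S : Set (Tree L)) : Prop :=
  ∀ T ∈ S, ∀ T' ∈ S, ∀ p q, Valid p T → Valid q T' → sub p T = sub q T' → T = T' ∧ p = q

theorem Generic.mono {S S' : Set (Tree L)} (hS : Generic S) (h : S' ⊆ S) : Generic S' :=
  fun T hT T' hT' => hS T (h hT) T' (h hT')

/-- All the variables of a term are at depth at least `n`. -/
def Deep {α : Type*} : ℕ → L.Term α → Prop
  | 0, _ => True
  | _ + 1, .var _ => False
  | n + 1, .func _ ts => ∀ i, Deep n (ts i)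

theorem Deep.mono {α : Type*} {n m : ℕ} (h : n ≤ m) {t : L.Term α} (ht : Deep m t) : Deep n t := by
  induction n generalizing m t with
  | zero => trivial
  | succ n ih =>
    obtain ⟨m, rfl⟩ : ∃ k, m = k + 1 := ⟨m - 1, by omega⟩
    match t, ht with
    | .func f ts, ht => exact fun i => ih (Nat.le_of_succ_le_succ h) (ht i)

/-- Replace each variable by its root applied to its immediate subtrees. -/
def unfold (t : L.Term (Tree L)) : L.Term (Tree L) :=
  t.subst fun T => T.root.app fun i => .var (child i T)

theorem Deep.unfold {n : ℕ} {t : L.Term (Tree L)} (ht : Deep n t) : Deep (n + 1) (unfold t) := by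
  induction t generalizing n with
  | var T =>
    match n, ht with
    | 0, _ => exact fun i => trivial
  | func f ts ih =>
    match n, ht with
    | 0, _ => exact fun i => trivial
    | n + 1, ht => exact fun i => ih i (ht i)

/-- A position below a child is a nonempty position below its parent, so a coincidence of subtrees
lifts to the parents. -/
theorem Generic.unfold {t : L.Term (Tree L)} (ht : Generic (termVars t)) :
    Generic (termVars (unfold t)) := by
  have h : ∀ T ∈ termVars (Tree.unfold t), ∃ T₀ ∈ termVars t, ∃ i, i < T₀.root.arity ∧
      T = child i T₀ := by
    intro T hT
    obtain ⟨T₀, h0, h1⟩ := mem_termVars_subst.1 hT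
    obtain ⟨i, hi⟩ := mem_termVars_func.1 h1
    exact ⟨T₀, h0, (i : Fin T₀.root.arity), i.2, hi⟩
  intro T hT T' hT' p q hp hq hpq
  obtain ⟨T, hT₀, i, hi, rfl⟩ := h T hT
  obtain ⟨T', hT₀', j, hj, rfl⟩ := h T' hT'
  obtain ⟨rfl, h2⟩ := ht T hT₀ T' hT₀' (i :: p) (j :: q) ⟨hi, hp⟩ ⟨hj, hq⟩ hpq
  obtain ⟨rfl, rfl⟩ := List.cons.inj h2
  exact ⟨rfl, rfl⟩

/-- Validity of p excludes the missing directions, at which `child` does not move. The reversal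
comes from the convention on positions. -/
theorem sub_growTree {ι : Type*} (ω : ι × List ℕ → Sym L) (n : ι) (q p : List ℕ)
    (hp : Valid p (growTree fun r => ω (n, r ++ q))) :
    sub p (growTree fun r => ω (n, r ++ q)) = growTree fun r => ω (n, r ++ (p.reverse ++ q)) := by
  induction p generalizing q with
  | nil => rfl
  | cons i p ih =>
    obtain ⟨hi, hp⟩ := hp
    rw [root_growTree] at hi
    rw [child_growTree, if_pos hi] at hp
    rw [sub, child_growTree, if_pos hi]
    simp only [List.append_assoc] at hp ⊢
    rw [ih _ hp]
    simp

theorem arity_pos [IsEmpty (L.Functions 0)] (f : Sym L) : 0 < f.arity := by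
  obtain ⟨n, f⟩ := f
  cases n with
  | zero => exact isEmptyElim f
  | succ n => exact Nat.succ_pos n

/-- The condition that all the subtrees of a random family of trees are different. -/
def InjectiveGrowth {ι : Type*} (ω : ι × List ℕ → Sym L) : Prop :=
  Function.Injective fun a : ι × List ℕ => growTree fun r => ω (a.1, r ++ a.2)

/-- The common depth d makes the splitting of a position into its part above and its part below
depth d unique. -/
theorem InjectiveGrowth.generic {ι : Type*} {ω : ι × List ℕ → Sym L} (hω : InjectiveGrowth ω)
    {S : Set (Tree L)} {d : ℕ} (hS : ∀ T ∈ S, ∃ n q, q.length = d ∧ T = growTree fun r => ω (n, r ++ q)) :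
    Generic S := by
  intro T hT T' hT' p q hp hq hpq
  obtain ⟨n, r, hr, rfl⟩ := hS T hT
  obtain ⟨n', r', hr', rfl⟩ := hS T' hT'
  rw [sub_growTree _ _ _ _ hp, sub_growTree _ _ _ _ hq] at hpq
  obtain ⟨rfl, h⟩ := Prod.mk.inj (hω (a₁ := (n, _)) (a₂ := (n', _)) hpq)
  obtain ⟨h1, rfl⟩ := List.append_inj' h (hr.trans hr'.symm)
  exact ⟨rfl, List.reverse_injective h1⟩

variable [L.IsAlgebraic]

theorem realize_unfold (t : L.Term (Tree L)) : (unfold t).realize id = t.realize id := by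
  rw [unfold, Term.realize_subst]
  exact realize_congr t fun T _ => node_root_child T

/-- Trees that are instances of a term at generic trees. -/
def IsGood (x : Tree L) : Prop :=
  ∃ t : L.Term (Tree L), Generic (termVars t) ∧ t.realize id = x

theorem IsGood.exists_deep {x : Tree L} (hx : IsGood x) (n : ℕ) :
    ∃ t : L.Term (Tree L), Generic (termVars t) ∧ t.realize id = x ∧ Deep n t := by
  induction n with
  | zero => obtain ⟨t, h1, h2⟩ := hx; exact ⟨t, h1, h2, trivial⟩
  | succ n ih =>
    obtain ⟨t, h1, h2, h3⟩ := ih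
    exact ⟨unfold t, h1.unfold, by rw [realize_unfold, h2], h3.unfold⟩

variable [IsEmpty (L.Functions 0)]

theorem exists_sub_realize_id (t : L.Term (Tree L)) :
    ∃ T ∈ termVars t, ∃ p, Valid p (t.realize id) ∧ sub p (t.realize id) = T := by
  induction t with
  | var T => exact ⟨T, rfl, [], trivial, rfl⟩
  | func f ts ih =>
    have h0 := arity_pos ⟨_, f⟩
    obtain ⟨T, hT, p, hp, hs⟩ := ih ⟨0, h0⟩
    rw [← child_funMap f (fun i => (ts i).realize id) h0] at hp hs
    exact ⟨T, mem_termVars_func.2 ⟨_, hT⟩, 0 :: p, ⟨h0, hp⟩, hs⟩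

/-- Going down direction 0, which exists as there is no constant, one reaches a variable of the
term, itself in S. It would be a proper subtree of T, against genericity. -/
theorem Generic.ne_realize_func {S : Set (Tree L)} (hS : Generic S) {T : Tree L} (hT : T ∈ S)
    {n : ℕ} {f : L.Functions n} {ts : Fin n → L.Term (Tree L)}
    (h : termVars (Term.func f ts) ⊆ S) : (Term.func f ts).realize id ≠ T := by
  intro he
  have h0 := arity_pos ⟨_, f⟩
  obtain ⟨T', hT', p, hp, hs⟩ := exists_sub_realize_id (ts ⟨0, h0⟩)
  rw [← child_funMap f (fun i => (ts i).realize id) h0] at hp hs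
  have := hS T hT T' (h (mem_termVars_func.2 ⟨_, hT'⟩)) (0 :: p) [] (he ▸ ⟨h0, hp⟩) trivial
    (he ▸ hs)
  exact List.cons_ne_nil _ _ this.2

/-- Generic trees are free generators: no nontrivial equation between finite terms holds among them.
-/
theorem Generic.realize_injective {S : Set (Tree L)} (hS : Generic S) {a b : L.Term (Tree L)}
    (ha : termVars a ⊆ S) (hb : termVars b ⊆ S) (h : a.realize id = b.realize id) : a = b := by
  induction a generalizing b with
  | var T =>
    cases b with
    | var T' => rw [show T = T' from h]
    | func g us => exact absurd h.symm (hS.ne_realize_func (ha rfl) hb)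
  | func f ts ih =>
    cases b with
    | var T' => exact absurd h (hS.ne_realize_func (hb rfl) ha)
    | func g us =>
      have := FreeConstructors.inj _ _ _ _ h
      obtain ⟨rfl, h2⟩ := Sigma.mk.inj this
      obtain ⟨rfl, h3⟩ := Prod.mk.inj (eq_of_heq h2)
      congr 1
      funext i
      exact ih i (fun T hT => ha (mem_termVars_func.2 ⟨i, hT⟩))
        (fun T hT => hb (mem_termVars_func.2 ⟨i, hT⟩)) (congrFun h3 i)

/-- A deep term with generic variables is an instance of the terms of which its value is. -/
theorem Generic.exists_eq_subst {t : L.Term (Tree L)} (ht : Generic (termVars t)) {u : L.Term ℕ}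
    (hd : Deep (termSize u) t) (h : t.realize id ∈ openTerm (Tree L) u) :
    ∃ s : ℕ → L.Term (Tree L), t = u.subst s := by
  classical
  obtain ⟨R, hR⟩ := h
  -- For n in u, a term over the variables of t with value R n exists and is unique by genericity,
  -- so all occurrences of n agree. The default value concerns only the other variables.
  set s : ℕ → L.Term (Tree L) := fun n =>
    if h : ∃ a, termVars a ⊆ termVars t ∧ a.realize id = R n then h.choose else .var (R n) with hs
  refine ⟨s, ?_⟩
  have key : ∀ (u : L.Term ℕ) (t' : L.Term (Tree L)), termVars t' ⊆ termVars t →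
      Deep (termSize u) t' → u.realize R = t'.realize id → t' = u.subst s := by
    intro u
    induction u with
    | var n =>
      intro t' hv _ h
      have hex : ∃ a, termVars a ⊆ termVars t ∧ a.realize id = R n := ⟨t', hv, h.symm⟩
      have : s n = hex.choose := dif_pos hex
      rw [Term.subst, this]
      exact ht.realize_injective hv hex.choose_spec.1 (h.symm.trans hex.choose_spec.2.symm)
    | func f us ih =>
      intro t' hv hd h
      -- The depth is now a successor, so `t'` cannot be a variable at a function symbol of u.
      rw [termSize, add_comm] at hd
      match t', hv, hd, h with
      | .func g ts, hv, hd, h =>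
        have := FreeConstructors.inj _ _ _ _ h
        obtain ⟨rfl, h2⟩ := Sigma.mk.inj this
        obtain ⟨rfl, h3⟩ := Prod.mk.inj (eq_of_heq h2)
        simp only [Term.subst]
        congr 1
        funext i
        exact ih i (ts i) (fun T hT => hv (mem_termVars_func.2 ⟨i, hT⟩))
          ((hd i).mono (Finset.single_le_sum (f := fun i => termSize (us i))
            (fun _ _ => Nat.zero_le _) (Finset.mem_univ i))) (congrFun h3 i)
  exact key u t subset_rfl hd hR

/-- A good tree has arbitrarily deep presentations by unfolding, and a sufficiently deep one is an
instance of both terms at once. -/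
theorem isUnifying (hex : ∀ t : L.Term ℕ, ∃ x ∈ openTerm (Tree L) t, IsGood x) :
    IsUnifying L (X := Tree L) IsGood where
  common_instance := by
    intro x hx t t' ht ht'
    obtain ⟨w, h1, rfl, h3⟩ := hx.exists_deep (max (termSize t) (termSize t'))
    obtain ⟨s, hs⟩ := h1.exists_eq_subst (h3.mono (le_max_left _ _)) ht
    obtain ⟨s', hs'⟩ := h1.exists_eq_subst (h3.mono (le_max_right _ _)) ht'
    -- The variables of the presentation are trees; they are numbered injectively to obtain a term
    -- on ℕ.
    obtain ⟨g, hg⟩ := Set.countable_iff_exists_injOn.1 (finite_termVars w).countable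
    refine ⟨w.relabel g, fun n => (s n).relabel g, fun n => (s' n).relabel g, ?_, ?_, ?_⟩
    · rw [← subst_relabel, ← hs]
    · rw [← subst_relabel, ← hs']
    · have : Nonempty (Tree L) := ⟨w.realize id⟩
      refine ⟨Function.invFunOn g (termVars w), ?_⟩
      simp only [Term.realize_relabel]
      exact realize_congr w fun T hT => hg.leftInvOn_invFunOn hT
  map := by
    intro F x hx hxt
    obtain ⟨w, h1, rfl, h3⟩ := hx.exists_deep (termSize F.t)
    obtain ⟨s, rfl⟩ := h1.exists_eq_subst h3 hxt
    refine ⟨F.u.subst s, h1.mono fun T hT => ?_, ?_⟩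
    · obtain ⟨n, hn, hT⟩ := mem_termVars_subst.1 hT
      exact mem_termVars_subst.2 ⟨n, (F.mem_termVars_iff n).1 hn, hT⟩
    · rw [Term.realize_subst, Term.realize_subst, F.map_realize]
  exists_mem := hex

end Tree

end GenericTrees

/-! ### Independent labels -/

section Labels

/-- The preimage of a box under reindexing is a box on the image indices; injectivity preserves the
product of the masses. -/
theorem map_infinitePi_comp {ι κ S : Type*} [MeasurableSpace S] [Nonempty κ] (ν : Measure S)
    [IsProbabilityMeasure ν] {c : κ → ι} (hc : Function.Injective c) :
    (Measure.infinitePi fun _ : ι => ν).map (fun ω k => ω (c k)) =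
      Measure.infinitePi fun _ : κ => ν := by
  refine Measure.eq_infinitePi _ fun s t ht => ?_
  have hm : Measurable fun (ω : ι → S) k => ω (c k) :=
    measurable_pi_lambda _ fun k => measurable_pi_apply (c k)
  rw [Measure.map_apply hm (.pi s.countable_toSet fun k _ => ht k)]
  have : (fun (ω : ι → S) k => ω (c k)) ⁻¹' Set.pi s t =
      Set.pi (s.map ⟨c, hc⟩) fun i => t (Function.invFun c i) := by
    ext ω
    simp [Set.mem_pi, Function.leftInverse_invFun hc _]
  rw [this, Measure.infinitePi_pi _ fun i _ => ht _, Finset.prod_map]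
  exact Finset.prod_congr rfl fun k _ => by
    rw [Function.Embedding.coeFn_mk, Function.leftInverse_invFun hc k]

/-- Infinitely many independent pairs of labels are not all equal. -/
theorem ae_exists_ne {S : Type*} [MeasurableSpace S] [MeasurableSingletonClass S] (ν : Measure S)
    [IsProbabilityMeasure ν] {f g : S} (hfg : f ≠ g) (hf : ν {f} ≠ 0) (hg : ν {g} ≠ 0) :
    ∀ᵐ ω ∂(Measure.infinitePi fun _ : ℕ × Bool => ν), ∃ k, ω (k, false) ≠ ω (k, true) := by
  set t : ℕ × Bool → Set S := fun a => if a.2 then {g} else {f} with ht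
  have htm : ∀ a, MeasurableSet (t a) := by
    rintro ⟨k, _ | _⟩ <;> simp [ht]
  -- B k is the event that the k-th pair is (f, g). These events are independent of constant
  -- positive probability, so the second Borel–Cantelli lemma applies.
  set B : ℕ → Set (ℕ × Bool → S) := fun k => Set.pi ↑(({k} : Finset ℕ) ×ˢ (Finset.univ : Finset Bool)) t
    with hB
  have hBs : ∀ s : Finset ℕ, ⋂ k ∈ s, B k = Set.pi ↑(s ×ˢ (Finset.univ : Finset Bool)) t := by
    intro s
    ext ω
    simp only [hB, Set.mem_iInter, Set.mem_pi, Finset.coe_product, Set.mem_prod, Finset.mem_coe,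
      Finset.mem_univ, and_true, Prod.forall, Finset.mem_singleton]
    exact ⟨fun h k b hk => h k hk k b rfl, fun h k hk k' b hb => h k' b (hb ▸ hk)⟩
  have hprod : ∀ s : Finset ℕ, Measure.infinitePi (fun _ : ℕ × Bool => ν)
      (Set.pi ↑(s ×ˢ (Finset.univ : Finset Bool)) t) = ∏ k ∈ s, (ν {g} * ν {f}) := by
    intro s
    rw [Measure.infinitePi_pi _ fun i _ => htm i, Finset.prod_product]
    simp [ht]
  have hBm : ∀ k, MeasurableSet (B k) := fun k => .pi (Finset.countable_toSet _) fun a _ => htm a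
  have hBp : ∀ k, Measure.infinitePi (fun _ : ℕ × Bool => ν) (B k) = ν {g} * ν {f} := fun k => by
    rw [hB, hprod, Finset.prod_singleton]
  have hind : ProbabilityTheory.iIndepSet B (Measure.infinitePi fun _ : ℕ × Bool => ν) := by
    rw [ProbabilityTheory.iIndepSet_iff_meas_biInter hBm]
    intro s
    rw [hBs, hprod]
    exact Finset.prod_congr rfl fun k _ => (hBp k).symm
  have h1 := ProbabilityTheory.measure_limsup_eq_one hBm hind (by
    simp only [hBp]
    exact ENNReal.tsum_const_eq_top_of_ne_zero (mul_ne_zero hg hf))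
  rw [← mem_ae_iff_prob_eq_one (.measurableSet_limsup hBm)] at h1
  filter_upwards [h1] with ω hω
  rw [Filter.mem_limsup_iff_frequently_mem] at hω
  obtain ⟨k, hk⟩ := hω.exists
  refine ⟨k, ?_⟩
  have e1 : ω (k, false) = f := by simpa [ht] using hk (k, false) (by simp)
  have e2 : ω (k, true) = g := by simpa [ht] using hk (k, true) (by simp)
  rw [e1, e2]
  exact hfg

end Labels

/-! ### Random trees -/

section RandomTrees

namespace Tree

theorem valid_replicate [IsEmpty (L.Functions 0)] (k : ℕ) (x : Tree L) :
    Valid (List.replicate k 0) x := by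
  induction k generalizing x with
  | zero => trivial
  | succ k ih => exact ⟨arity_pos _, ih _⟩

/-- The subtrees of independent random trees are different almost surely. -/
theorem ae_injectiveGrowth [IsEmpty (L.Functions 0)] [Nontrivial (Sym L)] {p : PMF (Sym L)}
    (hp : ∀ f, p f ≠ 0) :
    ∀ᵐ ω ∂(Measure.infinitePi fun _ : ℕ × List ℕ => p.toMeasure), InjectiveGrowth ω := by
  obtain ⟨f, g, hfg⟩ := exists_pair_ne (Sym L)
  have hp' : ∀ f, p.toMeasure {f} ≠ 0 := fun f => by
    rw [PMF.toMeasure_apply_singleton _ _ (.of_discrete)]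
    exact hp f
  have key : ∀ a b : ℕ × List ℕ, a ≠ b → ∀ᵐ ω ∂(Measure.infinitePi fun _ : ℕ × List ℕ =>
      p.toMeasure), (growTree fun r => ω (a.1, r ++ a.2)) ≠ growTree fun r => ω (b.1, r ++ b.2) := by
    rintro ⟨n, q⟩ ⟨m, r⟩ hab
    -- Labels are compared at depths D·k on the leftmost branches below the two positions. As D
    -- exceeds both lengths, the length of a position determines k, so all the labels compared sit
    -- at distinct indices and are independent.
    set D := q.length + r.length + 1 with hD
    have hlen : ∀ i j x y : ℕ, x < D → y < D → D * i + x = D * j + y → i = j := by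
      intro i j x y hx hy h
      have := congrArg (· / D) h
      simpa [Nat.mul_add_div (by omega : 0 < D), Nat.div_eq_of_lt hx, Nat.div_eq_of_lt hy] using this
    let c : ℕ × Bool → ℕ × List ℕ := fun k =>
      if k.2 then (m, List.replicate (D * k.1) 0 ++ r) else (n, List.replicate (D * k.1) 0 ++ q)
    have hc : Function.Injective c := by
      rintro ⟨i, x⟩ ⟨j, y⟩ h
      have hl := congrArg (fun z : ℕ × List ℕ => z.2.length) h
      have hij : i = j := by
        refine hlen i j (if x then r.length else q.length) (if y then r.length else q.length)
          (by split_ifs <;> omega) (by split_ifs <;> omega) ?_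
        cases x <;> cases y <;> simpa [c] using hl
      subst hij
      cases x <;> cases y <;> simp [c] at h ⊢
      · exact hab (Prod.ext h.1 h.2)
      · exact hab (Prod.ext h.1.symm h.2.symm)
    have h1 := ae_exists_ne p.toMeasure hfg (hp' f) (hp' g)
    rw [← map_infinitePi_comp p.toMeasure hc] at h1
    have hm : Measurable fun (ω : ℕ × List ℕ → Sym L) k => ω (c k) :=
      measurable_pi_lambda _ fun k => measurable_pi_apply (c k)
    filter_upwards [ae_of_ae_map hm.aemeasurable h1] with ω ⟨k, hk⟩ he
    apply hk
    have h2 := congrArg (fun x => (sub (List.replicate (D * k) 0) x).root) he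
    simp only [sub_growTree _ _ _ _ (valid_replicate _ _), root_growTree, List.reverse_replicate,
      List.nil_append] at h2
    exact h2
  have h := ae_all_iff.2 fun a : ℕ × List ℕ => ae_all_iff.2 fun b : ℕ × List ℕ =>
    (ae_all_iff (ι := a ≠ b)).2 (key a b)
  filter_upwards [h] with ω hω a b hab
  by_contra hne
  exact hω a b hne hab

variable [L.IsAlgebraic]

theorem measurable_realize_growTree [Countable (Sym L)] (v : L.Term ℕ) :
    Measurable fun ω : ℕ × List ℕ → Sym L => v.realize fun n => growTree fun q => ω (n, q) := by
  refine (LabelMeasurable.realize v fun n => ?_).measurable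
  simpa using labelMeasurable_growTree n ([] : List ℕ)

theorem InjectiveGrowth.isGood_realize {ω : ℕ × List ℕ → Sym L} (hω : InjectiveGrowth ω)
    (v : L.Term ℕ) : IsGood (v.realize fun n => growTree fun q => ω (n, q)) := by
  refine ⟨v.relabel fun n => growTree fun q => ω (n, q), hω.generic (d := 0) fun T hT => ?_, ?_⟩
  · obtain ⟨n, -, rfl⟩ := mem_termVars_relabel.1 hT
    exact ⟨n, [], rfl, by simp⟩
  · rw [Term.realize_relabel]
    rfl

theorem measurable_valid [Countable (Sym L)] (p : List ℕ) :
    Measurable fun x : Tree L => Valid p x := by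
  induction p with
  | nil => exact measurable_const
  | cons i p ih =>
    have h : Measurable fun x : Tree L => i < x.root.arity :=
      (Measurable.of_discrete (f := fun f : Sym L => i < f.arity)).comp measurable_root
    exact h.and (ih.comp (measurable_child i))

/-- The laws are push-forwards, so an almost sure property of ω passes to trees through a measurable
set. Genericity is therefore expressed through the subtrees extracted at the variables of a term, by
countably many measurable conditions. -/
theorem exists_measurable_subset_isGood [Countable (Sym L)] : ∃ G : Set (Tree L), MeasurableSet G ∧
    (∀ x ∈ G, IsGood x) ∧ ∀ (ω : ℕ × List ℕ → Sym L), InjectiveGrowth ω → ∀ v : L.Term ℕ,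
      v.realize (fun n => growTree fun q => ω (n, q)) ∈ G := by
  have : Countable (Σ n, L.Functions n) := inferInstanceAs (Countable (Sym L))
  refine ⟨⋃ v : L.Term ℕ, openTerm (Tree L) v ∩ {x | ∀ n, n ∈ termVars v → ∀ m, m ∈ termVars v →
    ∀ p q, Valid p (extract v n x) → Valid q (extract v m x) →
      sub p (extract v n x) = sub q (extract v m x) → n = m ∧ p = q},
    .iUnion fun v => (measurableSet_openTerm v).inter ?_, ?_, ?_⟩
  · have hx : ∀ n, Measurable (extract v n : Tree L → Tree L) := fun n => measurable_sub _
    refine measurableSet_setOfPred.2 <| .forall fun n => .imp measurable_const <| .forall fun m =>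
      .imp measurable_const <| .forall fun p => .forall fun q =>
      .imp ((measurable_valid p).comp (hx n)) <| .imp ((measurable_valid q).comp (hx m)) <|
      .imp ?_ measurable_const
    exact measurableSet_setOfPred.1 (measurableSet_eq _ _ ((measurable_sub p).comp (hx n))
      ((measurable_sub q).comp (hx m)))
  · intro x hx
    obtain ⟨v, hv, h⟩ := Set.mem_iUnion.1 hx
    refine ⟨v.relabel fun n => extract v n x, ?_, ?_⟩
    · intro T hT T' hT' p q hp hq hpq
      obtain ⟨n, hn, rfl⟩ := mem_termVars_relabel.1 hT
      obtain ⟨m, hm, rfl⟩ := mem_termVars_relabel.1 hT'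
      obtain ⟨rfl, rfl⟩ := h n hn m hm p q hp hq hpq
      exact ⟨rfl, rfl⟩
    · rw [Term.realize_relabel]
      exact (mem_openTerm_iff v x).1 hv
  · intro ω hω v
    refine Set.mem_iUnion.2 ⟨v, ⟨_, rfl⟩, fun n hn m hm p q hp hq hpq => ?_⟩
    rw [extract_realize hn] at hp hpq
    rw [extract_realize hm] at hq hpq
    have e : ∀ n, (growTree fun q => ω (n, q)) = growTree fun r => ω (n, r ++ []) := fun n => by simp
    rw [e] at hp hq
    rw [e n, e m, sub_growTree _ _ _ _ hp, sub_growTree _ _ _ _ hq] at hpq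
    obtain ⟨rfl, h⟩ := Prod.mk.inj (hω (a₁ := (n, _)) (a₂ := (m, _)) hpq)
    exact ⟨rfl, List.reverse_injective (List.append_cancel_right h)⟩

theorem instanceLaw_apply [Countable (Sym L)] (p : PMF (Sym L)) (v : L.Term ℕ) {A : Set (Tree L)}
    (hA : MeasurableSet A) : instanceLaw p v A =
      Measure.infinitePi (fun _ : ℕ × List ℕ => p.toMeasure)
        {ω | v.realize (fun n => growTree fun q => ω (n, q)) ∈ A} :=
  Measure.map_apply (measurable_realize_growTree v) hA

/-- Since every weight is nonzero, null sets are those that are null for the random instances of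
each term. -/
theorem treeMeasure_eq_zero_iff [Countable (Sym L)] {p : PMF (Sym L)} {w : L.Term ℕ → ENNReal}
    (hw : ∀ t, w t ≠ 0) (A : Set (Tree L)) :
    treeMeasure p w A = 0 ↔ ∀ v, instanceLaw p v A = 0 := by
  have : Countable (Σ n, L.Functions n) := inferInstanceAs (Countable (Sym L))
  rw [treeMeasure, Measure.sum_apply_eq_zero]
  simp [hw]

theorem ae_isGood [Countable (Sym L)] [IsEmpty (L.Functions 0)] [Nontrivial (Sym L)]
    {p : PMF (Sym L)} (hp : ∀ f, p f ≠ 0) {w : L.Term ℕ → ENNReal} (hw : ∀ t, w t ≠ 0) :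
    ∀ᵐ x ∂(treeMeasure p w), IsGood x := by
  obtain ⟨G, hG, h1, h2⟩ := exists_measurable_subset_isGood (L := L)
  have h0 : treeMeasure p w Gᶜ = 0 := by
    rw [treeMeasure_eq_zero_iff hw]
    intro v
    rw [instanceLaw_apply p v hG.compl]
    refine measure_mono_null (fun ω hω h => hω (h2 ω h v)) (ae_iff.1 (ae_injectiveGrowth hp))
  filter_upwards [measure_eq_zero_iff_ae_notMem.1 h0] with x hx
  exact h1 x (not_not.1 hx)

/-! ### Truncation of random trees -/

omit [L.IsAlgebraic] in
theorem growTree_append_eq_node (ω : ℕ × List ℕ → Sym L) (a : ℕ × List ℕ) :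
    (growTree fun r => ω (a.1, r ++ a.2)) =
      node (ω a) fun i => growTree fun r => ω (a.1, r ++ ((i : ℕ) :: a.2)) := by
  rw [growTree_eq_node]
  simp

/-- The truncation at depth `d` of an instance of a term at random trees. The variable `(n, q)`
stands for the subtree at the position `q` of the `n`-th tree. -/
def truncate (ω : ℕ × List ℕ → Sym L) (v : L.Term ℕ) : ℕ → L.Term (ℕ × List ℕ)
  | 0 => v.relabel fun n => (n, [])
  | d + 1 => (truncate ω v d).subst fun a => (ω a).app fun i => .var (a.1, (i : ℕ) :: a.2)

theorem realize_truncate (ω : ℕ × List ℕ → Sym L) (v : L.Term ℕ) (d : ℕ) :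
    (truncate ω v d).realize (fun a => growTree fun r => ω (a.1, r ++ a.2)) =
      v.realize fun n => growTree fun q => ω (n, q) := by
  induction d with
  | zero => simp [truncate, Term.realize_relabel, Function.comp_def]
  | succ d ih =>
    rw [truncate, Term.realize_subst, ← ih]
    exact realize_congr _ fun a _ => (growTree_append_eq_node ω a).symm

omit [L.IsAlgebraic] in
theorem length_of_mem_truncate {ω : ℕ × List ℕ → Sym L} {v : L.Term ℕ} {d : ℕ} {a : ℕ × List ℕ}
    (ha : a ∈ termVars (truncate ω v d)) : a.2.length = d := by
  induction d generalizing a with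
  | zero =>
    obtain ⟨n, -, rfl⟩ := mem_termVars_relabel.1 ha
    rfl
  | succ d ih =>
    obtain ⟨b, hb, h⟩ := mem_termVars_subst.1 ha
    obtain ⟨i, hi⟩ := mem_termVars_func.1 h
    rw [mem_termVars_var.1 hi, List.length_cons, ih hb]

omit [L.IsAlgebraic] in
theorem deep_truncate (ω : ℕ × List ℕ → Sym L) (v : L.Term ℕ) (d : ℕ) :
    Deep d (truncate ω v d) := by
  have h : ∀ (d : ℕ) (t : L.Term (ℕ × List ℕ)), Deep d t →
      Deep (d + 1) (t.subst fun a => (ω a).app fun i => .var (a.1, (i : ℕ) :: a.2)) := by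
    intro d t
    induction t generalizing d with
    | var a =>
      intro ht
      match d, ht with
      | 0, _ => exact fun i => trivial
    | func f ts ih =>
      intro ht
      match d, ht with
      | 0, _ => exact fun i => trivial
      | d + 1, ht => exact fun i => ih i d (ht i)
  induction d with
  | zero => trivial
  | succ d ih => exact h d _ ih

omit [L.IsAlgebraic] in
theorem Deep.relabel {α β : Type*} (g : α → β) {d : ℕ} {t : L.Term α} (ht : Deep d t) :
    Deep d (t.relabel g) := by
  induction t generalizing d with
  | var a =>
    match d, ht with
    | 0, _ => trivial
  | func f ts ih =>
    match d, ht with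
    | 0, _ => trivial
    | d + 1, ht => exact fun i => ih i (ht i)

/-- At depth `termSize u` the truncation is deep enough for `Generic.exists_eq_subst`. Distinct
positions carry distinct subtrees, so the generic trees can be renamed back to positions. -/
theorem InjectiveGrowth.truncate_eq_subst [IsEmpty (L.Functions 0)] {ω : ℕ × List ℕ → Sym L}
    (hω : InjectiveGrowth ω) {u v : L.Term ℕ}
    (h : v.realize (fun n => growTree fun q => ω (n, q)) ∈ openTerm (Tree L) u) :
    ∃ s : ℕ → L.Term (ℕ × List ℕ), truncate ω v (termSize u) = u.subst s := by
  set R : ℕ × List ℕ → Tree L := fun a => growTree fun r => ω (a.1, r ++ a.2) with hR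
  set t := truncate ω v (termSize u) with ht
  have hgen : Generic (termVars (t.relabel R)) := hω.generic (d := termSize u) fun T hT => by
    obtain ⟨a, ha, rfl⟩ := mem_termVars_relabel.1 hT
    exact ⟨a.1, a.2, length_of_mem_truncate ha, rfl⟩
  obtain ⟨s, hs⟩ := hgen.exists_eq_subst (u := u) ((deep_truncate ω v _).relabel R) (by
    rw [Term.realize_relabel]
    exact (realize_truncate ω v (termSize u)).symm ▸ h)
  refine ⟨fun n => (s n).relabel (Function.invFun R), ?_⟩
  have hR' : ∀ a ∈ termVars t, (Function.invFun R ∘ R) a = id a := fun a _ =>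
    Function.leftInverse_invFun hω a
  rw [← subst_relabel, ← hs, Term.relabel_relabel, relabel_congr t hR', Term.relabel_id]

/-- The random instances of a term at the subtrees at depth `d` have the law of its random
instances. -/
theorem exists_relabel_law [Countable (Sym L)] (p : PMF (Sym L)) (d : ℕ) :
    ∃ g : ℕ × List ℕ → ℕ, ∀ t : L.Term (ℕ × List ℕ), (∀ a ∈ termVars t, a.2.length = d) →
      ∀ A : Set (Tree L), MeasurableSet A →
        Measure.infinitePi (fun _ : ℕ × List ℕ => p.toMeasure)
          {ω | t.realize (fun a => growTree fun r => ω (a.1, r ++ a.2)) ∈ A} =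
            instanceLaw p (t.relabel g) A := by
  classical
  have : Infinite {a : ℕ × List ℕ // a.2.length = d} :=
    Infinite.of_injective (fun n : ℕ => ⟨(n, List.replicate d 0), by simp⟩) fun n m h => by
      simpa using h
  obtain ⟨e⟩ : Nonempty (ℕ ≃ {a : ℕ × List ℕ // a.2.length = d}) := nonempty_equiv_of_countable
  let g : ℕ × List ℕ → ℕ := fun a => if h : a.2.length = d then e.symm ⟨a, h⟩ else 0
  -- The trees rooted at the positions of depth d use disjoint sets of labels: c is injective
  -- because all these positions have the same length. They are thus again independent random trees,
  -- numbered by e.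
  let c : ℕ × List ℕ → ℕ × List ℕ := fun a => ((e a.1).1.1, a.2 ++ (e a.1).1.2)
  have hc : Function.Injective c := by
    rintro ⟨m, q⟩ ⟨n, r⟩ h
    obtain ⟨h1, h2⟩ := Prod.mk.inj h
    obtain ⟨h3, h4⟩ := List.append_inj' h2 ((e m).2.trans (e n).2.symm)
    exact Prod.ext (e.injective (Subtype.ext (Prod.ext h1 h4))) h3
  have hm : Measurable fun (ω : ℕ × List ℕ → Sym L) k => ω (c k) :=
    measurable_pi_lambda _ fun k => measurable_pi_apply (c k)
  refine ⟨g, fun t ht A hA => ?_⟩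
  have hmap := Measure.map_apply (μ := Measure.infinitePi fun _ : ℕ × List ℕ => p.toMeasure) hm
    (measurable_realize_growTree (t.relabel g) hA)
  rw [map_infinitePi_comp p.toMeasure hc] at hmap
  refine Eq.trans ?_ (hmap.symm.trans (instanceLaw_apply p _ hA).symm)
  congr 1
  ext ω
  simp only [Set.mem_ofPred_eq, Set.mem_preimage, Term.realize_relabel]
  rw [realize_congr t fun a ha => ?_]
  simp only [Function.comp_apply, g, c, dif_pos (ht a ha), Equiv.apply_symm_apply]

/-- A set of instances of `u` which is not null has instances of an instance of `u` with positive
probability. -/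
theorem exists_instanceLaw_subst_ne_zero [Countable (Sym L)] [IsEmpty (L.Functions 0)]
    [Nontrivial (Sym L)] {p : PMF (Sym L)} (hp : ∀ f, p f ≠ 0) {A : Set (Tree L)}
    (hA : MeasurableSet A) {u v : L.Term ℕ} (hAu : A ⊆ openTerm (Tree L) u)
    (h : instanceLaw p v A ≠ 0) : ∃ s : ℕ → L.Term ℕ, instanceLaw p (u.subst s) A ≠ 0 := by
  have : Countable (Σ n, L.Functions n) := inferInstanceAs (Countable (Sym L))
  obtain ⟨g, hg⟩ := exists_relabel_law p (termSize u)
  set P := Measure.infinitePi (fun _ : ℕ × List ℕ => p.toMeasure) with hP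
  -- There are countably many possible truncations, so one of them occurs with positive probability
  -- together with the event.
  have h1 : ∃ t : L.Term (ℕ × List ℕ), P {ω | InjectiveGrowth ω ∧
      v.realize (fun n => growTree fun q => ω (n, q)) ∈ A ∧ truncate ω v (termSize u) = t} ≠ 0 := by
    by_contra! h0
    refine h ?_
    rw [instanceLaw_apply p v hA]
    refine measure_mono_null (fun ω hω => ?_)
      (measure_union_null (ae_iff.1 (ae_injectiveGrowth hp)) (measure_iUnion_null h0))
    by_cases hi : InjectiveGrowth ω
    · exact Or.inr (Set.mem_iUnion.2 ⟨_, hi, hω, rfl⟩)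
    · exact Or.inl hi
  obtain ⟨t, ht⟩ := h1
  obtain ⟨ω, hω, hv, rfl⟩ := nonempty_of_measure_ne_zero ht
  obtain ⟨s, hs⟩ := hω.truncate_eq_subst (hAu hv)
  refine ⟨fun n => (s n).relabel g, ?_⟩
  rw [← subst_relabel, ← hs, ← hg _ (fun a ha => length_of_mem_truncate ha) A hA]
  -- The truncation depends on ω, but replacing it by the fixed term t only enlarges the event.
  refine fun h0 => ht (measure_mono_null ?_ h0)
  rintro ω' ⟨-, hv', ht'⟩
  rw [Set.mem_ofPred_eq, ← ht', realize_truncate]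
  exact hv'

/-- If the image were charged, it would be charged by the law of some uθ. With the same random
assignment, the value of uθ is in the image exactly when that of tθ is in A, so A would be charged
too. -/
theorem treeMeasure_image_eq_zero [Countable (Sym L)] [IsEmpty (L.Functions 0)]
    [Nontrivial (Sym L)] {p : PMF (Sym L)} (hp : ∀ f, p f ≠ 0) {w : L.Term ℕ → ENNReal}
    (hw : ∀ t, w t ≠ 0) (F : Flow L) {A : Set (Tree L)} (hA : MeasurableSet A)
    (hAt : A ⊆ openTerm (Tree L) F.t) (h : treeMeasure p w A = 0) :
    treeMeasure p w (F.map '' A) = 0 := by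
  rw [treeMeasure_eq_zero_iff hw] at h ⊢
  by_contra! hne
  obtain ⟨v, hv⟩ := hne
  have hm := measurableSet_image_flowMap F hA
  obtain ⟨s, hs⟩ := exists_instanceLaw_subst_ne_zero hp hm (u := F.u)
    (by rw [← F.image_map]; exact Set.image_mono hAt) hv
  refine hs (le_antisymm (le_trans ?_ (h (F.t.subst s)).le) zero_le)
  rw [instanceLaw_apply p _ hm, instanceLaw_apply p _ hA]
  refine measure_mono ?_
  rintro ω ⟨x, hx, he⟩
  rw [Term.realize_subst, ← F.map_realize] at he
  have hxe := F.map_injOn (hAt hx) ⟨_, rfl⟩ he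
  dsimp only at hxe
  rw [Set.mem_ofPred_eq, Term.realize_subst, ← hxe]
  exact hx

/-- The map is the identity outside 𝒪(t). Inside, null sets have null images, and the converse is
the same fact for the adjoint flow. -/
theorem inMacrocosm_flowMap [Countable (Sym L)] [IsEmpty (L.Functions 0)]
    [Nontrivial (Sym L)] {p : PMF (Sym L)} (hp : ∀ f, p f ≠ 0) {w : L.Term ℕ → ENNReal}
    (hw : ∀ t, w t ≠ 0) (F : Flow L) : InMacrocosm (treeMeasure p w) (F.map : Tree L → Tree L) where
  measurable := measurable_flowMap F
  image_measurable := fun A hA => measurableSet_image_flowMap F hA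
  nonsingular := by
    intro A hA
    have hO := measurableSet_openTerm (L := L) F.t
    have hout : F.map '' (A \ openTerm (Tree L) F.t) = A \ openTerm (Tree L) F.t := by
      conv_rhs => rw [← Set.image_id (A \ openTerm (Tree L) F.t)]
      exact Set.image_congr fun x hx => F.map_of_notMem hx.2
    have hsplit : F.map '' A = F.map '' (A ∩ openTerm (Tree L) F.t) ∪
        A \ openTerm (Tree L) F.t := by
      rw [← hout, ← Set.image_union, Set.inter_union_sdiff]
    rw [hsplit, measure_union_null_iff]
    constructor
    · rintro ⟨h1, h2⟩
      rw [← Set.inter_union_sdiff A (openTerm (Tree L) F.t)]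
      refine measure_union_null ?_ h2
      have h3 := treeMeasure_image_eq_zero hp hw F.adj (measurableSet_image_flowMap F (hA.inter hO))
        ((Set.image_mono Set.inter_subset_right).trans F.image_map.subset) h1
      rw [Set.image_image, Set.image_congr fun x hx => F.adj_map_map hx.2, Set.image_id'] at h3
      exact h3
    · intro h
      exact ⟨treeMeasure_image_eq_zero hp hw F (hA.inter hO) Set.inter_subset_right
        (measure_mono_null Set.inter_subset_left h), measure_mono_null Set.sdiff_subset h⟩

theorem commutesWithExecution [IsEmpty (L.Functions 0)] [Nontrivial (Sym L)] (Ω : Type w)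
    [Monoid Ω] {p : PMF (Sym L)} (hp : ∀ f, p f ≠ 0) {w : L.Term ℕ → ENNReal} (hw : ∀ t, w t ≠ 0) :
    CommutesWithExecution L Ω (treeMeasure p w) := by
  -- A probability law with full support exists only on a countable set.
  have : Countable (Sym L) := by
    rw [← Set.countable_univ_iff, ← Set.eq_univ_of_forall fun f => (p.mem_support_iff f).2 (hp f)]
    exact p.support_countable
  refine commutesWithExecution_of_isUnifying (isUnifying fun t => ?_) (ae_isGood hp hw)
    measurableSet_openTerm (inMacrocosm_flowMap hp hw) measurableSet_eq
  obtain ⟨ω, hω⟩ := (ae_injectiveGrowth (L := L) hp).exists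
  exact ⟨_, ⟨_, rfl⟩, hω.isGood_realize t⟩

end Tree

end RandomTrees

end Unification

end

theorem mainTheorem9 (L : FirstOrder.Language.{u, v}) [L.IsAlgebraic] (Ω : Type w) [Monoid Ω] :
    -- non-free signatures: finite closed terms with the counting measure
    (Nonempty (L.Functions 0) →
      Unification.CommutesWithExecution L Ω
        (Measure.count : Measure (Unification.ClosedTerm L))) ∧
    -- free signatures: infinite trees
    (IsEmpty (L.Functions 0) → Nontrivial (Unification.Sym L) →
      ∀ p : PMF (Unification.Sym L), (∀ f, p f ≠ 0) →
      ∀ w : L.Term ℕ → ENNReal, (∀ t, w t ≠ 0) → ∑' t, w t ≠ ⊤ →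
        Unification.CommutesWithExecution L Ω (Unification.treeMeasure p w)) := by
  refine ⟨fun h => ?_, fun h1 h2 p hp w hw _ => ?_⟩
  · have := h
    exact Unification.ClosedTerm.commutesWithExecution Ω
  · have := h1
    have := h2
    exact Unification.Tree.commutesWithExecution Ω hp hw
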